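/- **Unique solvability of the boundary vorticity stabilisation (BVS) method in generalised Laplacian form.** Let $d\in\{2,3\}$, $k\in\mathbb N$, $\kappa>0$ and $Q\ge 1$. There is a constant $C>0$, depending only on $d,k,\kappa,Q$, such that the following holds. Let $\Omega\subset\mathbb R^d$ be a bounded domain with Lipschitz boundary $\Gamma$ and outward unit normal $\mathbf n$, and let $\mathcal T$ be a finite conforming simplicial triangulation of $\overline\Omega$ with element diameters $h_e$ and mesh size $h=\max_e h_e$, which is shape-regular (each element contains a ball of diameter at least $h_e/\kappa$) and quasi-uniform ($h/h_e\le Q$ for all $e$). Let $X_h\subset[H^1_0(\Omega)]^d$ and $Y_h\subset H^1(\Omega)\cap L^2_0(\Omega)$ be linear spaces of continuous functions on $\overline\Omega$ that are polynomials of degree at most $k$ on each element, where the functions in $X_h$ are vector-valued and vanish on $\Gamma$, and those in $Y_h$ are scalar with zero mean on $\Omega$. Let $\mathbf f\in[L^2(\Omega)]^d$, let $\nu\in W^{1,\infty}(\Omega)$ (identified with its representative that is continuous on $\overline\Omega$) satisfy $0<\nu_{\min}\le\nu\le\nu_{\max}<\infty$ in $\Omega$, and let $\sigma,\delta\in\mathbb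 R$ satisfy $$\sigma\ge 3\,\frac{\|\nabla\nu\|_\infty^2}{\nu_{\min}},\qquad 0<\delta\le\frac{\nu_{\min}h^2/12}{h^2\|\nabla\nu\|_\infty^2+C\nu_{\max}^2},$$ where $\|\nabla\nu\|_\infty$ is the $L^\infty(\Omega)$ norm of the Euclidean length of $\nabla\nu$. Then there is exactly one pair $(\mathbf u_h,p_h)\in X_h\times Y_h$ such that, for all $\mathbf v_h\in X_h$ and $q_h\in Y_h$, $$\sigma(\mathbf u_h,\mathbf v_h)+(\nu\nabla\mathbf u_h,\nabla\mathbf v_h)-(\nabla^{\top}\mathbf u_h\nabla\nu,\mathbf v_h)-(p_h,\nabla\cdot\mathbf v_h)=(\mathbf f,\mathbf v_h),$$ $$(q_h,\nabla\cdot\mathbf u_h)+\delta(\nabla q_h,\nabla p_h-2\nabla^{\top}\mathbf u_h\nabla\nu)+\delta(\nabla q_h\times\mathbf n,\nu\nabla\times\mathbf u_h)_{\Gamma}=(\mathbf f,\delta\nabla q_h).$$ Moreover, the bilinear form $A_{\mathrm{GL}}((\mathbf v_h,q_h),(\mathbf u_h,p_h))$ given by the sum of the two left-hand sides is coercive: $$A_{\mathrm{GL}}((\mathbf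 v_h,q_h),(\mathbf v_h,q_h))\ \ge\ \tfrac12\left(\sigma\|\mathbf v_h\|^2+\nu_{\min}\|\nabla\mathbf v_h\|^2+\delta\|\nabla q_h\|^2\right)\quad\text{for all }(\mathbf v_h,q_h)\in X_h\times Y_h.$$ Here $(\cdot,\cdot)$ and $\|\cdot\|$ are the inner product and norm of $L^2(\Omega)$; $(\cdot,\cdot)_\Gamma$ is the inner product of $L^2(\Gamma)$, where on each boundary face the traces of $\nabla q_h$ and $\nabla\times\mathbf u_h$ are taken from the adjacent element; $(\nabla\mathbf u)_{ij}=\partial_ju_i$, so that $(\nabla^{\top}\mathbf u\nabla\nu)_i=\sum_j\partial_iu_j\,\partial_j\nu$; and for $d=2$, $\mathbf a\times\mathbf b=a_1b_2-a_2b_1$ and $\nabla\times\mathbf u=\partial_1u_2-\partial_2u_1$. -/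

import Mathlib

open MeasureTheory Set Topology
open scoped Matrix

noncomputable section

/-- `ℝ^d` with the Euclidean norm. -/
abbrev Euc (d : ℕ) : Type := EuclideanSpace ℝ (Fin d)

/-! ### Domain and viscosity space -/

/-- A bounded domain with Lipschitz boundary: a nonempty bounded connected open set which, near every
boundary point and after a rotation of the coordinates, lies strictly above the graph of a Lipschitz
function. Here `e` is the "vertical" unit direction, and `x - ⟪e, x⟫ e` is the horizontal part of `x`. -/
structure IsLipschitzDomain {d : ℕ} (Ω : Set (Euc d)) : Prop where
  isOpen : IsOpen Ω
  isConnected : IsConnected Ω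
  isBounded : Bornology.IsBounded Ω
  graph : ∀ x₀ ∈ frontier Ω, ∃ e : Euc d, ‖e‖ = 1 ∧ ∃ (L : NNReal) (γ : Euc d → ℝ),
    LipschitzWith L γ ∧ ∃ U ∈ 𝓝 x₀, ∀ x ∈ U,
      (x ∈ Ω ↔ γ (x - (inner ℝ e x : ℝ) • e) < (inner ℝ e x : ℝ))

/-- `g` is the weak gradient of `ν` in `Ω`. -/
def HasWeakGradient {d : ℕ} (Ω : Set (Euc d)) (ν : Euc d → ℝ) (g : Euc d → Euc d) : Prop :=
  ∀ φ : Euc d → ℝ, ContDiff ℝ ((⊤ : ℕ∞) : WithTop ℕ∞) φ → HasCompactSupport φ → tsupport φ ⊆ Ω →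
    ∀ i : Fin d, ∫ x in Ω, ν x * fderiv ℝ φ x (EuclideanSpace.single i 1) = -∫ x in Ω, g x i * φ x

/-- `ν ∈ W^{1,∞}(Ω)` with weak gradient `g`, where `ν` is the representative that is continuous up to
the boundary (it exists for every element of `W^{1,∞}(Ω)` as `Ω` is a Lipschitz domain, and its
restriction to the boundary is the trace). -/
structure IsW1Infty {d : ℕ} (Ω : Set (Euc d)) (ν : Euc d → ℝ) (g : Euc d → Euc d) : Prop where
  memLp : MemLp ν ⊤ (volume.restrict Ω)
  memLp_grad : MemLp g ⊤ (volume.restrict Ω)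
  weakGradient : HasWeakGradient Ω ν g
  continuousOn : ContinuousOn ν (closure Ω)

/-- The norm of `L^∞(Ω)^d` (with the Euclidean norm of the values). -/
def supNorm {d : ℕ} (Ω : Set (Euc d)) (g : Euc d → Euc d) : ℝ :=
  (eLpNorm g ⊤ (volume.restrict Ω)).toReal

/-! ### Triangulations -/

/-- The elements of a triangulation, given by their sets of `d + 1` vertices; the element itself is the
(closed) convex hull of its vertices. -/
def elements {d : ℕ} (K : Geometry.SimplicialComplex ℝ (Euc d)) : Set (Finset (Euc d)) :=
  {t | t ∈ K.faces ∧ t.card = d + 1}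

/-- `K` is a (conforming, finite) triangulation of `Ω` into `d`-simplices. -/
structure IsTriangulation {d : ℕ} (Ω : Set (Euc d)) (K : Geometry.SimplicialComplex ℝ (Euc d)) :
    Prop where
  finite : K.faces.Finite
  pure : ∀ s ∈ K.faces, ∃ t ∈ elements K, s ⊆ t
  space_eq : K.space = closure Ω

/-- The size `h_e` (diameter) of an element. -/
def elementSize {d : ℕ} (t : Finset (Euc d)) : ℝ := Metric.diam (convexHull ℝ (t : Set (Euc d)))

/-- The mesh size `h`: the maximum element size. -/
def meshSize {d : ℕ} (K : Geometry.SimplicialComplex ℝ (Euc d)) : ℝ :=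
  sSup (elementSize '' elements K)

/-- Shape regularity with constant `κ`: every element contains a ball whose diameter `2 r` satisfies
`h_e ≤ κ (2 r)`. -/
def IsShapeRegular {d : ℕ} (K : Geometry.SimplicialComplex ℝ (Euc d)) (κ : ℝ) : Prop :=
  ∀ t ∈ elements K, ∃ (c : Euc d) (r : ℝ), 0 < r ∧
    Metric.closedBall c r ⊆ convexHull ℝ (t : Set (Euc d)) ∧ elementSize t ≤ κ * (2 * r)

/-- Global quasi-uniformity with constant `Q`: `h / h_e ≤ Q` for all elements. -/
def IsQuasiUniform {d : ℕ} (K : Geometry.SimplicialComplex ℝ (Euc d)) (Q : ℝ) : Prop :=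
  ∀ t ∈ elements K, meshSize K / elementSize t ≤ Q

/-! ### Continuous finite element functions -/

/-- `q` is a polynomial of total degree at most `k` on each element. -/
def IsPiecewisePoly {d : ℕ} (K : Geometry.SimplicialComplex ℝ (Euc d)) (k : ℕ) (q : Euc d → ℝ) :
    Prop :=
  ∀ t ∈ elements K, ∃ P : MvPolynomial (Fin d) ℝ, P.totalDegree ≤ k ∧
    ∀ x ∈ convexHull ℝ (t : Set (Euc d)), q x = MvPolynomial.eval (fun i => x i) P

/-- A continuous, piecewise polynomial vector field vanishing on the boundary, that is, an
`[H¹₀(Ω)]^d`-conforming finite element function (extended by zero outside `Ω`). -/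
structure IsDiscreteVelocity {d : ℕ} (Ω : Set (Euc d)) (K : Geometry.SimplicialComplex ℝ (Euc d))
    (k : ℕ) (v : Euc d → Euc d) : Prop where
  continuousOn : ContinuousOn v (closure Ω)
  piecewisePoly : ∀ i : Fin d, IsPiecewisePoly K k fun x => v x i
  eq_zero_boundary : ∀ x ∈ frontier Ω, v x = 0
  eq_zero_outside : ∀ x ∉ closure Ω, v x = 0

/-- A continuous, piecewise polynomial scalar function with zero mean on `Ω`, that is, an
`H¹(Ω) ∩ L²₀(Ω)`-conforming finite element function. It is a function on the closure of `Ω`; its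
values outside are normalised to zero. -/
structure IsDiscretePressure {d : ℕ} (Ω : Set (Euc d)) (K : Geometry.SimplicialComplex ℝ (Euc d))
    (k : ℕ) (q : Euc d → ℝ) : Prop where
  continuousOn : ContinuousOn q (closure Ω)
  piecewisePoly : IsPiecewisePoly K k q
  zero_mean : ∫ x in Ω, q x = 0
  eq_zero_outside : ∀ x ∉ closure Ω, q x = 0

/-! ### Differential operators -/

/-- The matrix of a linear map in the standard basis. -/
def matrixOf {d : ℕ} (L : Euc d →L[ℝ] Euc d) : Matrix (Fin d) (Fin d) ℝ :=
  Matrix.of fun i j => L (EuclideanSpace.single j 1) i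

/-- The velocity gradient `(∇u)_{ij} = ∂_j u_i`. For a finite element function it is the classical
gradient in the interior of each element, hence the weak gradient almost everywhere in `Ω`. -/
def jac {d : ℕ} (u : Euc d → Euc d) (x : Euc d) : Matrix (Fin d) (Fin d) ℝ :=
  matrixOf (fderiv ℝ u x)

/-- The velocity gradient taken from within the closed element with vertex set `t`. -/
def jacElem {d : ℕ} (t : Finset (Euc d)) (u : Euc d → Euc d) (x : Euc d) :
    Matrix (Fin d) (Fin d) ℝ :=
  matrixOf (fderivWithin ℝ u (convexHull ℝ (t : Set (Euc d))) x)

/-- The pressure gradient taken from within the closed element with vertex set `t`. -/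
def gradElem {d : ℕ} (t : Finset (Euc d)) (q : Euc d → ℝ) (x : Euc d) : Euc d :=
  gradientWithin q (convexHull ℝ (t : Set (Euc d))) x

/-- The vector field `∇ᵀu ∇ν`, with components `∑ⱼ ∂_i u_j ∂_j ν`; here `g = ∇ν`. -/
def gradTMul {d : ℕ} (u : Euc d → Euc d) (g : Euc d → Euc d) (x : Euc d) : Euc d :=
  WithLp.toLp 2 ((jac u x)ᵀ *ᵥ (g x).ofLp)

/-- `(a × b) · (∇ × u)` in dimensions two and three, where `J = ∇u`. In dimension two,
`a × b = a₁ b₂ - a₂ b₁` and `∇ × u = ∂₁ u₂ - ∂₂ u₁` are scalars. (Not used for other `d`.) -/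
def crossDotCurl : (d : ℕ) → (Fin d → ℝ) → (Fin d → ℝ) → Matrix (Fin d) (Fin d) ℝ → ℝ
  | 2, a, b, J => (a 0 * b 1 - a 1 * b 0) * (J 1 0 - J 0 1)
  | 3, a, b, J => (a ⨯₃ b) ⬝ᵥ ![J 2 1 - J 1 2, J 0 2 - J 2 0, J 1 0 - J 0 1]
  | _, _, _, _ => 0

/-- The outward unit normal of the simplex with vertex set `t` on its face opposite to the vertex `a`:
the component of `centroid - a` orthogonal to the face, normalised. -/
def outwardNormal {d : ℕ} [DecidableEq (Euc d)] (t : Finset (Euc d)) (a : Euc d) : Euc d :=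
  let w : Euc d := (vectorSpan ℝ ((t.erase a : Finset (Euc d)) : Set (Euc d)))ᗮ.starProjection
    ((t.erase a).centroid ℝ id - a)
  ‖w‖⁻¹ • w

/-! ### The discrete problem -/

open Classical in
/-- The boundary term `(∇q × n, ν ∇ × u)_Γ`: the sum, over all elements `t` and all faces of `t` that
lie on `Γ = ∂Ω`, of the surface integrals of the traces taken from within `t`. -/
def boundaryTerm {d : ℕ} (Ω : Set (Euc d)) (K : Geometry.SimplicialComplex ℝ (Euc d))
    (ν : Euc d → ℝ) (q : Euc d → ℝ) (u : Euc d → Euc d) : ℝ :=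
  ∑ᶠ t ∈ elements K,
    ∑ a ∈ t with convexHull ℝ ((t.erase a : Finset (Euc d)) : Set (Euc d)) ⊆ frontier Ω,
      ∫ x in convexHull ℝ ((t.erase a : Finset (Euc d)) : Set (Euc d)),
        ν x * crossDotCurl d (gradElem t q x).ofLp (outwardNormal t a).ofLp (jacElem t u x)
          ∂(μHE[d - 1] : Measure (Euc d))

/-- The left-hand side of the momentum equation,
`σ(u,v) + (ν∇u,∇v) - (∇ᵀu∇ν,v) - (p,∇·v)`, where `g = ∇ν`. -/
def momentumForm {d : ℕ} (Ω : Set (Euc d)) (σ : ℝ) (ν : Euc d → ℝ) (g : Euc d → Euc d)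
    (u : Euc d → Euc d) (p : Euc d → ℝ) (v : Euc d → Euc d) : ℝ :=
  σ * (∫ x in Ω, (inner ℝ (u x) (v x) : ℝ))
    + (∫ x in Ω, ν x * ∑ i, ∑ j, jac u x i j * jac v x i j)
    - (∫ x in Ω, (inner ℝ (gradTMul u g x) (v x) : ℝ))
    - ∫ x in Ω, p x * (jac v x).trace

/-- The left-hand side of the stabilised continuity equation,
`(q,∇·u) + δ(∇q,∇p - 2∇ᵀu∇ν) + δ(∇q × n,ν∇ × u)_Γ`, where `g = ∇ν`. -/
def continuityForm {d : ℕ} (Ω : Set (Euc d)) (K : Geometry.SimplicialComplex ℝ (Euc d)) (δ : ℝ)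
    (ν : Euc d → ℝ) (g : Euc d → Euc d) (u : Euc d → Euc d) (p : Euc d → ℝ) (q : Euc d → ℝ) : ℝ :=
  (∫ x in Ω, q x * (jac u x).trace)
    + δ * (∫ x in Ω, (inner ℝ (gradient q x) (gradient p x - (2 : ℝ) • gradTMul u g x) : ℝ))
    + δ * boundaryTerm Ω K ν q u

/-- The bilinear form `A_GL((v,q),(u,p))`. -/
def bilinearGL {d : ℕ} (Ω : Set (Euc d)) (K : Geometry.SimplicialComplex ℝ (Euc d)) (σ δ : ℝ)
    (ν : Euc d → ℝ) (g : Euc d → Euc d) (vq up : (Euc d → Euc d) × (Euc d → ℝ)) : ℝ :=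
  momentumForm Ω σ ν g up.1 up.2 vq.1 + continuityForm Ω K δ ν g up.1 up.2 vq.2

/-- The mesh-dependent norm `(σ‖v‖² + ν_min‖∇v‖² + δ‖∇q‖²)^{1/2}`. -/
def meshNorm {d : ℕ} (Ω : Set (Euc d)) (σ δ νmin : ℝ) (vq : (Euc d → Euc d) × (Euc d → ℝ)) : ℝ :=
  √(σ * (∫ x in Ω, ‖vq.1 x‖ ^ 2) + νmin * (∫ x in Ω, ∑ i, ∑ j, jac vq.1 x i j ^ 2)
    + δ * ∫ x in Ω, ‖gradient vq.2 x‖ ^ 2)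

/-- `(u, p) ∈ X × Y` solves the discrete problem: the momentum equation for all `v ∈ X` and the
stabilised continuity equation for all `q ∈ Y`. -/
structure IsBVSSolution {d : ℕ} (Ω : Set (Euc d)) (K : Geometry.SimplicialComplex ℝ (Euc d))
    (X : Submodule ℝ (Euc d → Euc d)) (Y : Submodule ℝ (Euc d → ℝ)) (σ δ : ℝ)
    (ν : Euc d → ℝ) (g : Euc d → Euc d) (f : Euc d → Euc d)
    (up : (Euc d → Euc d) × (Euc d → ℝ)) : Prop where
  velocity_mem : up.1 ∈ X
  pressure_mem : up.2 ∈ Y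
  momentum : ∀ v ∈ X, momentumForm Ω σ ν g up.1 up.2 v = ∫ x in Ω, (inner ℝ (f x) (v x) : ℝ)
  continuity : ∀ q ∈ Y, continuityForm Ω K δ ν g up.1 up.2 q
    = ∫ x in Ω, (inner ℝ (f x) (δ • gradient q x) : ℝ)

end

/-!
Coercivity rests on an inverse trace inequality. The pressure terms cancel on the diagonal, so that
`A((v, q), (v, q))` is `σ‖v‖² + (ν∇v, ∇v) + δ‖∇q‖²` plus three indefinite terms. The terms `(∇ᵀv∇ν, v)` and
`2δ(∇q, ∇ᵀv∇ν)` are handled pointwise by Young's inequality, with `3‖∇ν‖² ≤ σ νmin` for the first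
and the smallness of `δ` for the second. The boundary term is controlled by an inverse trace
inequality (`exists_boundaryTerm_le`): its bound is `‖∇q‖²/4 + C νmax² h⁻² ‖∇v‖²`, and multiplied
by `δ` this is absorbed as well (`coercive_bilinearGL`).

The inverse trace inequality needs no reference element. By shape regularity, an element of size
`h` contains a ball of radius proportional to `h` and lies in a concentric ball of proportional
radius. All norms on the polynomials of degree at most `k` are equivalent, so after scaling the
maximum of such a polynomial on the element is at most `C h^(-d/2)` times its `L²` norm
(`exists_sq_le_integral_cell`). A face has surface measure at most `C h^(d-1)`
(`measureReal_face_le`), which leaves the factor `1/h`. Summing over the elements uses that they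
overlap in null sets and fill the domain up to a null set. The latter holds because a Lipschitz
domain is the interior of its closure (`IsLipschitzDomain.interior_closure`), so that interiors of
elements lie in `Ω`.

For unique solvability, the form is bilinear on the finite-dimensional space `X × Y`, and
coercivity makes it definite: the mesh norm controls `∇v` and `∇q`, and a continuous piecewise
polynomial with vanishing gradient is constant on the connected set `closure Ω`
(`IsPiecewisePoly.exists_eq_const`), hence zero by the boundary condition or the mean value
condition. This does not use `σ > 0`, which may fail if `∇ν = 0`. A definite form on a
finite-dimensional space represents every functional uniquely.
-/

/-! ### Polynomials on Euclidean space -/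

/-- The polynomial function on `ℝ^d` given by `P`. -/
noncomputable def polyEval {d : ℕ} (P : MvPolynomial (Fin d) ℝ) (x : Euc d) : ℝ :=
  MvPolynomial.eval (fun i => x i) P

lemma continuous_polyEval {d : ℕ} (P : MvPolynomial (Fin d) ℝ) : Continuous (polyEval P) := by
  unfold polyEval
  exact (MvPolynomial.continuous_eval P).comp (by fun_prop)

lemma totalDegree_pderiv_le {d : ℕ} (i : Fin d) (P : MvPolynomial (Fin d) ℝ) :
    (MvPolynomial.pderiv i P).totalDegree ≤ P.totalDegree := by
  classical
  conv_lhs => rw [P.as_sum, map_sum]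
  refine MvPolynomial.totalDegree_finsetSum_le fun s hs => ?_
  rw [MvPolynomial.pderiv_monomial]
  refine (MvPolynomial.totalDegree_monomial_le _ _).trans
    (le_trans ?_ (MvPolynomial.le_totalDegree hs))
  change Finsupp.degree _ ≤ Finsupp.degree s
  exact Finsupp.degree_mono tsub_le_self

lemma hasFDerivAt_polyEval {d : ℕ} (P : MvPolynomial (Fin d) ℝ) (x : Euc d) :
    HasFDerivAt (polyEval P)
      (∑ i, polyEval (MvPolynomial.pderiv i P) x • (EuclideanSpace.proj i : Euc d →L[ℝ] ℝ)) x := by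
  induction P using MvPolynomial.induction_on with
  | C a =>
    have h : polyEval (MvPolynomial.C a : MvPolynomial (Fin d) ℝ) = fun _ => a := by
      funext y; simp [polyEval]
    rw [h]
    simpa [polyEval] using hasFDerivAt_const a x
  | add P Q hP hQ =>
    have h : polyEval (P + Q) = polyEval P + polyEval Q := by funext y; simp [polyEval]
    rw [h]
    refine (hP.add hQ).congr_fderiv ?_
    simp [polyEval, add_smul, Finset.sum_add_distrib]
  | mul_X P j hP =>
    have h : polyEval (P * MvPolynomial.X j) = fun y => polyEval P y * y j := by
      funext y; simp [polyEval]
    rw [h]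
    have hj : HasFDerivAt (fun y : Euc d => y j) (EuclideanSpace.proj j : Euc d →L[ℝ] ℝ) x :=
      (EuclideanSpace.proj j : Euc d →L[ℝ] ℝ).hasFDerivAt
    refine (hP.mul hj).congr_fderiv ?_
    ext v
    simp [polyEval, MvPolynomial.pderiv_X, Finset.mul_sum, add_mul, Finset.sum_add_distrib,
      Pi.single_apply, apply_ite]
    exact Finset.sum_congr rfl fun i _ => by ring

/-- Substituting an affine map for the variables does not raise the degree. -/
lemma exists_polyEval_affine {d : ℕ} (P : MvPolynomial (Fin d) ℝ) (c : Euc d) (r : ℝ) :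
    ∃ P' : MvPolynomial (Fin d) ℝ, P'.totalDegree ≤ P.totalDegree ∧
      ∀ y, polyEval P' y = polyEval P (c + r • y) := by
  classical
  refine ⟨MvPolynomial.aeval
      (fun i => MvPolynomial.C (c i) + MvPolynomial.C r * MvPolynomial.X i) P,
    ?_, fun y => ?_⟩
  · conv_lhs => rw [P.as_sum, map_sum]
    refine MvPolynomial.totalDegree_finsetSum_le fun s hs => ?_
    refine le_trans ?_ (MvPolynomial.le_totalDegree hs)
    rw [MvPolynomial.aeval_monomial]
    refine (MvPolynomial.totalDegree_mul _ _).trans ?_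
    rw [MvPolynomial.algebraMap_eq, MvPolynomial.totalDegree_C, zero_add, Finsupp.prod]
    refine (MvPolynomial.totalDegree_finsetProd _ _).trans ?_
    refine Finset.sum_le_sum fun i _ => ?_
    refine (MvPolynomial.totalDegree_pow _ _).trans ?_
    refine (Nat.mul_le_mul_left _ (?_ : _ ≤ 1)).trans (mul_one _).le
    refine (MvPolynomial.totalDegree_add _ _).trans (max_le (by simp) ?_)
    refine (MvPolynomial.totalDegree_mul _ _).trans (by simp)
  · simp only [polyEval]
    rw [← MvPolynomial.coe_aeval_eq_eval, RingHom.coe_coe, ← AlgHom.comp_apply,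
      MvPolynomial.comp_aeval, ← MvPolynomial.coe_aeval_eq_eval, RingHom.coe_coe]
    congr 2
    funext i
    simp

lemma eq_zero_of_polyEval_eq_zero_on_ball {d : ℕ} (P : MvPolynomial (Fin d) ℝ)
    (h : ∀ x ∈ Metric.ball (0 : Euc d) 1, polyEval P x = 0) : P = 0 := by
  rcases Nat.eq_zero_or_pos d with rfl | hd
  · refine MvPolynomial.funext fun y => ?_
    have := h (WithLp.toLp 2 y) (by simp [Subsingleton.elim (WithLp.toLp 2 y) 0])
    simpa [polyEval] using this
  -- The ball contains the cube `(0, 1/d)^d`, a product of infinite sets.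
  refine MvPolynomial.funext_set (fun _ => Set.Ioo 0 ((d : ℝ)⁻¹)) (fun i => ?_) fun y hy => ?_
  · exact Set.Ioo_infinite (by positivity)
  · have := h (WithLp.toLp 2 y) (by
      rw [mem_ball_zero_iff, EuclideanSpace.norm_eq, Real.sqrt_lt' one_pos]
      have h0 : ∀ i, ‖y i‖ ^ 2 < ((d : ℝ)⁻¹) := fun i => by
        have h1 := hy i trivial
        simp only [Set.mem_Ioo] at h1
        have h2 : (d : ℝ)⁻¹ ≤ 1 := inv_le_one_of_one_le₀ (by exact_mod_cast hd)
        rw [Real.norm_eq_abs, sq_abs]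
        nlinarith
      have : Nonempty (Fin d) := ⟨⟨0, hd⟩⟩
      calc ∑ i, ‖y i‖ ^ 2 < ∑ i : Fin d, ((d : ℝ)⁻¹) :=
            Finset.sum_lt_sum_of_nonempty Finset.univ_nonempty fun i _ => h0 i
        _ = 1 ^ 2 := by
          have : (d : ℝ) ≠ 0 := by positivity
          simp [this])
    simpa [polyEval] using this

lemma integrableOn_polyEval_sq {d : ℕ} (P : MvPolynomial (Fin d) ℝ) (c : Euc d) (r : ℝ) :
    IntegrableOn (fun x => polyEval P x ^ 2) (Metric.ball c r) :=
  (((continuous_polyEval P).pow 2).continuousOn.integrableOn_compact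
    (isCompact_closedBall c r)).mono_set Metric.ball_subset_closedBall

/-- Equivalence of norms on the finite-dimensional space of polynomials of degree at most `k`. -/
lemma exists_sq_le_integral_unitBall (d k : ℕ) (R : ℝ) :
    ∃ C : ℝ, 0 < C ∧ ∀ P : MvPolynomial (Fin d) ℝ, P.totalDegree ≤ k →
      ∀ x ∈ Metric.closedBall (0 : Euc d) R,
        polyEval P x ^ 2 ≤ C * ∫ y in Metric.ball (0 : Euc d) 1, polyEval P y ^ 2 := by
  set V := MvPolynomial.restrictTotalDegree (Fin d) ℝ k
  set μ : Measure (Euc d) := volume.restrict (Metric.ball 0 1)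
  have hL (P : MvPolynomial (Fin d) ℝ) : MemLp (polyEval P) 2 μ :=
    (memLp_two_iff_integrable_sq (continuous_polyEval P).aestronglyMeasurable).2
      (integrableOn_polyEval_sq P 0 1)
  let T : V →ₗ[ℝ] Lp ℝ 2 μ :=
    { toFun := fun P => (hL P.1).toLp _
      map_add' := fun P Q => by
        rw [← MemLp.toLp_add]
        congr 1; funext y; simp [polyEval]
      map_smul' := fun a P => by
        rw [RingHom.id_apply, ← MemLp.toLp_const_smul]
        congr 1; funext y; simp [polyEval] }
  have hTinj : Function.Injective T := by
    rw [← LinearMap.ker_eq_bot, LinearMap.ker_eq_bot']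
    intro P hP
    have h1 : polyEval P.1 =ᵐ[μ] 0 := by
      have h2 := (hL P.1).coeFn_toLp
      have h3 : (hL P.1).toLp _ = 0 := hP
      rw [h3] at h2
      exact h2.symm.trans (Lp.coeFn_zero _ _ _)
    have h4 := Measure.eqOn_open_of_ae_eq h1 Metric.isOpen_ball
      (continuous_polyEval P.1).continuousOn continuousOn_const
    exact Subtype.ext (eq_zero_of_polyEval_eq_zero_on_ball P.1 fun x hx => h4 hx)
  let B := Metric.closedBall (0 : Euc d) R
  have : CompactSpace B := isCompact_iff_compactSpace.1 (isCompact_closedBall _ _)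
  let S : V →ₗ[ℝ] C(B, ℝ) :=
    { toFun := fun P => ⟨fun x => polyEval P.1 x,
        (continuous_polyEval P.1).comp continuous_subtype_val⟩
      map_add' := fun P Q => by ext y; simp [polyEval]
      map_smul' := fun a P => by ext y; simp [polyEval] }
  -- `S ∘ T⁻¹` is a linear map from a finite-dimensional normed space, hence bounded.
  let e := LinearEquiv.ofInjective T hTinj
  have : FiniteDimensional ℝ (LinearMap.range T) := inferInstance
  let L : LinearMap.range T →L[ℝ] C(B, ℝ) :=
    LinearMap.toContinuousLinearMap (S ∘ₗ e.symm.toLinearMap)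
  refine ⟨‖L‖ ^ 2 + 1, by positivity, fun P hP x hx => ?_⟩
  let P' : V := ⟨P, (MvPolynomial.mem_restrictTotalDegree _ _ _).2 hP⟩
  have h1 : L (e P') = S P' := by simp [L]
  have h2 : |polyEval P x| ≤ ‖L‖ * ‖T P'‖ := by
    calc |polyEval P x| = ‖S P' ⟨x, hx⟩‖ := rfl
      _ ≤ ‖S P'‖ := ContinuousMap.norm_coe_le_norm _ _
      _ ≤ ‖L‖ * ‖e P'‖ := by rw [← h1]; exact L.le_opNorm _
  have h3 : ‖T P'‖ ^ 2 = ∫ y in Metric.ball (0 : Euc d) 1, polyEval P y ^ 2 := by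
    rw [← real_inner_self_eq_norm_sq, L2.inner_def]
    refine integral_congr_ae ?_
    filter_upwards [(hL P).coeFn_toLp] with y hy
    have : (T P' : Lp ℝ 2 μ) y = polyEval P y := hy
    rw [this]; simp [sq]
  rw [← h3]
  calc polyEval P x ^ 2 = |polyEval P x| ^ 2 := (sq_abs _).symm
    _ ≤ (‖L‖ * ‖T P'‖) ^ 2 := by gcongr
    _ ≤ (‖L‖ ^ 2 + 1) * ‖T P'‖ ^ 2 := by nlinarith [sq_nonneg ‖T P'‖]

/-- A polynomial on a ball of radius `R r` is controlled by its `L²` norm on the concentric ball of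
radius `r`, with a constant independent of the ball. -/
lemma exists_sq_le_integral_ball (d k : ℕ) (R : ℝ) :
    ∃ C : ℝ, 0 < C ∧ ∀ P : MvPolynomial (Fin d) ℝ, P.totalDegree ≤ k →
      ∀ (c : Euc d) (r : ℝ), 0 < r → ∀ x ∈ Metric.closedBall c (R * r),
        polyEval P x ^ 2 ≤ C * (r ^ d)⁻¹ * ∫ y in Metric.ball c r, polyEval P y ^ 2 := by
  obtain ⟨C, hC, h⟩ := exists_sq_le_integral_unitBall d k R
  refine ⟨C, hC, fun P hP c r hr x hx => ?_⟩
  obtain ⟨P', hP', hev⟩ := exists_polyEval_affine P c r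
  have h1 := h P' (hP'.trans hP) (r⁻¹ • (x - c)) (by
    rw [mem_closedBall_zero_iff, norm_smul, Real.norm_of_nonneg (by positivity), ← dist_eq_norm]
    rw [Metric.mem_closedBall] at hx
    rw [inv_mul_le_iff₀ hr]; linarith)
  rw [hev, smul_inv_smul₀ hr.ne', add_sub_cancel] at h1
  refine h1.trans_eq ?_
  rw [mul_assoc]
  congr 1
  simp only [hev]
  have h2 := Measure.setIntegral_comp_smul_of_pos (volume : Measure (Euc d))
    (fun y => polyEval P (c + y) ^ 2) (Metric.ball 0 1) hr
  rw [h2, smul_eq_mul, finrank_euclideanSpace_fin, smul_unitBall_of_pos hr]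
  congr 1
  have h3 := (measurePreserving_add_left (volume : Measure (Euc d)) c).setIntegral_preimage_emb
    (measurableEmbedding_addLeft c) (fun y => polyEval P y ^ 2) (Metric.ball c r)
  rw [← h3]
  congr 2
  ext y; simp

/-! ### Simplices, faces and their measures -/

/-- The closed simplex with vertex set `t`. -/
abbrev cell {d : ℕ} (t : Finset (Euc d)) : Set (Euc d) := convexHull ℝ (t : Set (Euc d))

lemma isCompact_cell {d : ℕ} (t : Finset (Euc d)) : IsCompact (cell t) :=
  t.finite_toSet.isCompact_convexHull ℝ

lemma measurableSet_cell {d : ℕ} (t : Finset (Euc d)) : MeasurableSet (cell t) :=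
  (isCompact_cell t).measurableSet

lemma cell_subset_closedBall {d : ℕ} (t : Finset (Euc d)) {c : Euc d} (hc : c ∈ cell t) :
    cell t ⊆ Metric.closedBall c (elementSize t) := fun _ hx =>
  Metric.dist_le_diam_of_mem (isCompact_cell t).isBounded hx hc

lemma volume_convexHull_eq_zero {d : ℕ} (s : Finset (Euc d)) (hs : s.card ≤ d) :
    volume (cell s) = 0 := by
  classical
  rcases s.eq_empty_or_nonempty with rfl | hne
  · rw [cell, Finset.coe_empty, convexHull_empty, measure_empty]
  refine measure_mono_null (convexHull_subset_affineSpan _) (Measure.addHaar_affineSubspace _ _ ?_)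
  intro htop
  obtain ⟨n, hn⟩ : ∃ n, s.card = n + 1 := ⟨s.card - 1, by have := hne.card_pos; omega⟩
  have h1 := finrank_vectorSpan_image_finset_le ℝ (id : Euc d → Euc d) s hn
  rw [Finset.image_id, ← direction_affineSpan, htop, AffineSubspace.direction_top, finrank_top,
    finrank_euclideanSpace_fin] at h1
  omega

lemma volume_cell_inter {d : ℕ} {K : Geometry.SimplicialComplex ℝ (Euc d)} {s t : Finset (Euc d)}
    (hs : s ∈ elements K) (ht : t ∈ elements K) (hst : s ≠ t) : volume (cell s ∩ cell t) = 0 := by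
  classical
  refine measure_mono_null (K.inter_subset_convexHull hs.1 ht.1) ?_
  rw [← Finset.coe_inter]
  refine volume_convexHull_eq_zero _ ?_
  have h1 : (s ∩ t).card < s.card := by
    refine Finset.card_lt_card (Finset.inter_subset_left.ssubset_of_ne fun h => hst ?_)
    exact Finset.eq_of_subset_of_card_le (Finset.inter_eq_left.1 h) (by rw [hs.2, ht.2])
  have := hs.2
  omega

/-- The surface measure of a `(d-1)`-dimensional simplex of diameter at most `h` is at most that
of a ball of radius `h` in `ℝ^(d-1)`. -/
lemma euclideanHausdorffMeasure_cell_le {d : ℕ} (s : Finset (Euc d)) (n : ℕ) (hs : s.card = n + 1)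
    (hind : AffineIndependent ℝ ((↑) : s → Euc d)) (h : ℝ)
    (hh : ∀ x ∈ cell s, ∀ y ∈ cell s, dist x y ≤ h) :
    (μHE[n] : Measure (Euc d)) (cell s) ≤ volume (Metric.closedBall (0 : Euc n) h) := by
  classical
  obtain ⟨x₀, hx₀⟩ : s.Nonempty := Finset.card_pos.1 (by omega)
  set V := vectorSpan ℝ (s : Set (Euc d)) with hV
  have hrank : Module.finrank ℝ V = n := by
    have := hind.finrank_vectorSpan (n := n) (by simpa using hs)
    have h' : V = vectorSpan ℝ (range ((↑) : s → Euc d)) := by rw [Subtype.range_coe]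
    exact (congrArg (fun W : Submodule ℝ (Euc d) => Module.finrank ℝ W) h').trans this
  let φ : Euc n ≃ₗᵢ[ℝ] V := ((stdOrthonormalBasis ℝ V).reindex (finCongr hrank)).repr.symm
  have hφ : Isometry (fun y : Euc n => (φ y : Euc d) + x₀) :=
    (isometry_add_right x₀).comp (isometry_subtype_coe.comp φ.isometry)
  rw [← EuclideanSpace.euclideanHausdorffMeasure_eq_volume, ← hφ.euclideanHausdorffMeasure_image]
  refine measure_mono fun x hx => ?_
  have hx₀' : x₀ ∈ cell s := subset_convexHull ℝ _ hx₀
  have hxV : x - x₀ ∈ V := by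
    rw [hV, ← direction_affineSpan]
    exact AffineSubspace.vsub_mem_direction (convexHull_subset_affineSpan _ hx)
      (convexHull_subset_affineSpan _ hx₀')
  refine ⟨φ.symm ⟨x - x₀, hxV⟩, ?_, by simp⟩
  rw [mem_closedBall_zero_iff, LinearIsometryEquiv.norm_map, Submodule.coe_norm, ← dist_eq_norm]
  exact hh x hx x₀ hx₀'

/-- The faces of the elements of a triangulation have surface measure at most `c h_e^(d-1)`. -/
lemma measureReal_face_le {d : ℕ} (hd : 2 ≤ d) {K : Geometry.SimplicialComplex ℝ (Euc d)}
    {t : Finset (Euc d)} (ht : t ∈ elements K) [DecidableEq (Euc d)] {a : Euc d} (ha : a ∈ t) :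
    (μHE[d - 1] : Measure (Euc d)) (cell (t.erase a)) < ⊤ ∧
    (μHE[d - 1] : Measure (Euc d)).real (cell (t.erase a)) ≤
      (volume : Measure (Euc (d - 1))).real (Metric.closedBall 0 1) * elementSize t ^ (d - 1) := by
  have hcard : (t.erase a).card = (d - 1) + 1 := by
    rw [Finset.card_erase_of_mem ha, ht.2]; omega
  have hsub : cell (t.erase a) ⊆ cell t := convexHull_mono (by simp)
  have h1 := euclideanHausdorffMeasure_cell_le (t.erase a) (d - 1) hcard
    (K.indep (K.down_closed ht.1 (Finset.erase_subset _ _) (Finset.card_pos.1 (by omega))))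
    (elementSize t) fun x hx y hy =>
      Metric.dist_le_diam_of_mem (isCompact_cell t).isBounded (hsub hx) (hsub hy)
  have h2 : volume (Metric.closedBall (0 : Euc (d - 1)) (elementSize t)) < ⊤ :=
    measure_closedBall_lt_top
  refine ⟨h1.trans_lt h2, ?_⟩
  refine (ENNReal.toReal_mono h2.ne h1).trans_eq ?_
  have h0 : 0 ≤ elementSize t := Metric.diam_nonneg
  rw [Measure.addHaar_closedBall' _ _ h0, ENNReal.toReal_mul,
    ENNReal.toReal_ofReal (pow_nonneg h0 _), finrank_euclideanSpace_fin, mul_comm,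
    measureReal_def]

/-! ### Domains and triangulations -/

/-- A Lipschitz domain lies locally on one side of its boundary, so it fills the interior of its
closure. -/
lemma IsLipschitzDomain.interior_closure {d : ℕ} {Ω : Set (Euc d)} (hΩ : IsLipschitzDomain Ω) :
    interior (closure Ω) = Ω := by
  refine Subset.antisymm (fun x₀ hx₀ => ?_) (interior_maximal subset_closure hΩ.isOpen)
  by_contra hxΩ
  have hfr : x₀ ∈ frontier Ω := by
    rw [frontier, hΩ.isOpen.interior_eq]
    exact ⟨interior_subset hx₀, hxΩ⟩
  obtain ⟨e, he, L, γ, hγ, U, hU, hgraph⟩ := hΩ.graph x₀ hfr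
  have hee : inner ℝ e e = (1 : ℝ) := by rw [real_inner_self_eq_norm_sq, he, one_pow]
  have hγc := hγ.continuous
  have hx₀U : x₀ ∈ U := mem_of_mem_nhds hU
  have h0 : (inner ℝ e x₀ : ℝ) ≤ γ (x₀ - (inner ℝ e x₀ : ℝ) • e) := by
    by_contra! h
    exact hxΩ ((hgraph x₀ hx₀U).2 h)
  -- Points slightly below `x₀` lie strictly below the graph, hence have neighbourhoods missing `Ω`.
  have hcont : Filter.Tendsto (fun s : ℝ => x₀ - s • e) (𝓝[>] 0) (𝓝 x₀) := by
    have : Continuous fun s : ℝ => x₀ - s • e := by fun_prop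
    have h := this.tendsto 0
    simp only [zero_smul, sub_zero] at h
    exact h.mono_left nhdsWithin_le_nhds
  have hev := hcont.eventually
    ((isOpen_interior.eventually_mem hx₀).and
      (isOpen_interior.eventually_mem (mem_interior_iff_mem_nhds.2 hU)))
  obtain ⟨s, ⟨hs1, hs2⟩, hs0⟩ := (hev.and self_mem_nhdsWithin).exists
  have hs0 : 0 < s := hs0
  set y := x₀ - s • e with hy
  have hlt : (inner ℝ e y : ℝ) < γ (y - (inner ℝ e y : ℝ) • e) := by
    have h1 : (inner ℝ e y : ℝ) = inner ℝ e x₀ - s := by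
      rw [hy, inner_sub_right, inner_smul_right, hee, mul_one]
    have h2 : y - (inner ℝ e y : ℝ) • e = x₀ - (inner ℝ e x₀ : ℝ) • e := by
      rw [h1, hy, sub_smul]; abel
    rw [h2, h1]; linarith
  have hopen : IsOpen {z : Euc d | (inner ℝ e z : ℝ) < γ (z - (inner ℝ e z : ℝ) • e)} :=
    isOpen_lt (by fun_prop) (hγc.comp (by fun_prop))
  obtain ⟨z, ⟨hz1, hz2⟩, hzΩ⟩ := mem_closure_iff.1 (interior_subset hs1) _
    (hopen.inter isOpen_interior) ⟨hlt, hs2⟩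
  exact lt_asymm hz1 ((hgraph z (interior_subset hz2)).1 hzΩ)

section Triangulation

variable {d : ℕ} {Ω : Set (Euc d)} {K : Geometry.SimplicialComplex ℝ (Euc d)}

lemma IsLipschitzDomain.isFiniteMeasure (hΩ : IsLipschitzDomain Ω) :
    IsFiniteMeasure (volume.restrict Ω : Measure (Euc d)) :=
  isFiniteMeasure_restrict.2 hΩ.isBounded.measure_lt_top.ne

lemma IsTriangulation.finite_elements (hK : IsTriangulation Ω K) : (elements K).Finite :=
  hK.finite.subset fun _ h => h.1

lemma IsTriangulation.biUnion_cell (hK : IsTriangulation Ω K) :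
    ⋃ t ∈ elements K, cell t = closure Ω := by
  rw [← hK.space_eq]
  refine Subset.antisymm (iUnion₂_subset fun t ht => K.convexHull_subset_space ht.1) fun x hx => ?_
  obtain ⟨s, hs, hxs⟩ := Geometry.SimplicialComplex.mem_space_iff.1 hx
  obtain ⟨t, ht, hst⟩ := hK.pure s hs
  exact mem_iUnion₂.2 ⟨t, ht, convexHull_mono (by exact_mod_cast hst) hxs⟩

lemma IsTriangulation.cell_subset (hK : IsTriangulation Ω K) {t : Finset (Euc d)}
    (ht : t ∈ elements K) : cell t ⊆ closure Ω := by
  rw [← hK.biUnion_cell]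
  exact subset_biUnion_of_mem (u := fun t => cell t) ht

lemma IsTriangulation.exists_mem_cell (hK : IsTriangulation Ω K) {x : Euc d}
    (hx : x ∈ closure Ω) : ∃ t ∈ elements K, x ∈ cell t := by
  rw [← hK.biUnion_cell] at hx
  simpa using hx

lemma IsTriangulation.interior_cell_subset (hΩ : IsLipschitzDomain Ω) (hK : IsTriangulation Ω K)
    {t : Finset (Euc d)} (ht : t ∈ elements K) : interior (cell t) ⊆ Ω := by
  rw [← hΩ.interior_closure]
  exact interior_mono (hK.cell_subset ht)

lemma ae_mem_interior_of_mem_cell (t : Finset (Euc d)) :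
    ∀ᵐ x : Euc d, x ∈ cell t → x ∈ interior (cell t) := by
  have h := (convex_convexHull ℝ (t : Set (Euc d))).addHaar_frontier volume
  filter_upwards [measure_eq_zero_iff_ae_notMem.1 h] with x hx hxt
  by_contra hxi
  exact hx ⟨subset_closure hxt, hxi⟩

/-- Almost every point of the domain is interior to an element. -/
lemma IsTriangulation.ae_exists_mem_interior (hΩ : IsLipschitzDomain Ω) (hK : IsTriangulation Ω K) :
    ∀ᵐ x ∂(volume.restrict Ω), ∃ t ∈ elements K, x ∈ interior (cell t) := by
  rw [ae_restrict_iff' hΩ.isOpen.measurableSet]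
  have h := (ae_ball_iff hK.finite_elements.countable).2 fun t _ => ae_mem_interior_of_mem_cell t
  filter_upwards [h] with x hx hxΩ
  obtain ⟨t, ht, hxt⟩ := hK.exists_mem_cell (subset_closure hxΩ)
  exact ⟨t, ht, hx t ht hxt⟩

/-- The domain is open and equals the interior of its closure, so no measure is lost between it
and the union of the closed elements. -/
lemma IsTriangulation.ae_eq_biUnion (hΩ : IsLipschitzDomain Ω) (hK : IsTriangulation Ω K) :
    Ω =ᵐ[volume] (⋃ t ∈ elements K, cell t : Set (Euc d)) := by
  have h := (ae_ball_iff hK.finite_elements.countable).2 fun t _ => ae_mem_interior_of_mem_cell t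
  filter_upwards [h] with x hx
  refine propext ⟨fun (hxΩ : x ∈ Ω) => ?_,
    fun (hxU : x ∈ (⋃ t ∈ elements K, cell t : Set (Euc d))) => ?_⟩
  · change x ∈ (⋃ t ∈ elements K, cell t : Set (Euc d))
    rw [hK.biUnion_cell]; exact subset_closure hxΩ
  · obtain ⟨t, ht, hxt⟩ := mem_iUnion₂.1 hxU
    exact hK.interior_cell_subset hΩ ht (hx t ht hxt)

lemma IsTriangulation.setIntegral_eq_sum (hΩ : IsLipschitzDomain Ω) (hK : IsTriangulation Ω K)
    {f : Euc d → ℝ} (hf : IntegrableOn f Ω) :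
    ∫ x in Ω, f x = ∑ t ∈ hK.finite_elements.toFinset, ∫ x in cell t, f x := by
  have hae := hK.ae_eq_biUnion hΩ
  rw [setIntegral_congr_set hae]
  have := hK.finite_elements.to_subtype
  rw [biUnion_eq_iUnion] at hae ⊢
  rw [integral_iUnion_ae, tsum_subtype (elements K) fun t => ∫ x in cell t, f x,
    tsum_eq_sum (s := hK.finite_elements.toFinset)]
  · refine Finset.sum_congr rfl fun t ht => ?_
    rw [indicator_of_mem (by simpa using ht)]
  · intro t ht
    rw [indicator_of_notMem (by simpa using ht)]
  · exact fun t => (measurableSet_cell t.1).nullMeasurableSet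
  · intro s t hst
    exact volume_cell_inter s.2 t.2 fun h => hst (Subtype.ext h)
  · exact hf.congr_set_ae hae.symm

end Triangulation

/-! ### Bilinear forms given by integrals -/

section Bilinear

variable {E E' : Type*} [AddCommGroup E] [Module ℝ E] [AddCommGroup E'] [Module ℝ E']
  {α : Type*} [MeasurableSpace α] {μ : Measure α}

/-- A family of essentially bounded functions that depends linearly, up to null sets, on a vector.
Derivatives of finite element functions are of this kind: at points where the functions are not
differentiable, the junk values of the derivative are not additive. -/
structure AELinear (μ : Measure α) (φ : E → α → ℝ) : Prop where
  memLp : ∀ x, MemLp (φ x) ⊤ μ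
  map_add : ∀ x y, ∀ᵐ a ∂μ, φ (x + y) a = φ x a + φ y a
  map_smul : ∀ (c : ℝ) x, ∀ᵐ a ∂μ, φ (c • x) a = c * φ x a

lemma MeasureTheory.MemLp.mul_top {f g : α → ℝ} (hf : MemLp f ⊤ μ) (hg : MemLp g ⊤ μ) :
    MemLp (fun a => f a * g a) ⊤ μ :=
  hg.mul' hf

namespace AELinear

variable {φ ψ : E → α → ℝ}

lemma comp_linearMap (hφ : AELinear μ φ) (f : E' →ₗ[ℝ] E) : AELinear μ fun x => φ (f x) where
  memLp x := hφ.memLp _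
  map_add x y := by simpa using hφ.map_add (f x) (f y)
  map_smul c x := by simpa using hφ.map_smul c (f x)

lemma sub (hφ : AELinear μ φ) (hψ : AELinear μ ψ) : AELinear μ fun x a => φ x a - ψ x a where
  memLp x := (hφ.memLp x).sub (hψ.memLp x)
  map_add x y := by
    filter_upwards [hφ.map_add x y, hψ.map_add x y] with a h1 h2
    rw [h1, h2]; ring
  map_smul c x := by
    filter_upwards [hφ.map_smul c x, hψ.map_smul c x] with a h1 h2
    rw [h1, h2]; ring

lemma mul_left (hφ : AELinear μ φ) {m : α → ℝ} (hm : MemLp m ⊤ μ) :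
    AELinear μ fun x a => m a * φ x a where
  memLp x := hm.mul_top (hφ.memLp x)
  map_add x y := by
    filter_upwards [hφ.map_add x y] with a h1
    rw [h1]; ring
  map_smul c x := by
    filter_upwards [hφ.map_smul c x] with a h1
    rw [h1]; ring

lemma const_mul [IsFiniteMeasure μ] (hφ : AELinear μ φ) (c : ℝ) : AELinear μ fun x a => c * φ x a :=
  hφ.mul_left (memLp_const c)

lemma sum {ι : Type*} (s : Finset ι) {φ : ι → E → α → ℝ} (hφ : ∀ i ∈ s, AELinear μ (φ i)) :
    AELinear μ fun x a => ∑ i ∈ s, φ i x a where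
  memLp x := memLp_finsetSum s fun i hi => (hφ i hi).memLp x
  map_add x y := by
    filter_upwards [(s.eventually_all).2 fun i hi => (hφ i hi).map_add x y] with a h
    rw [← Finset.sum_add_distrib]
    exact Finset.sum_congr rfl h
  map_smul c x := by
    filter_upwards [(s.eventually_all).2 fun i hi => (hφ i hi).map_smul c x] with a h
    rw [Finset.mul_sum]
    exact Finset.sum_congr rfl h

lemma exists_linearMap (hφ : AELinear μ φ) {m : α → ℝ} (hm : Integrable m μ) :
    ∃ L : E →ₗ[ℝ] ℝ, ∀ x, L x = ∫ a, m a * φ x a ∂μ := by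
  have hint (x : E) : Integrable (fun a => m a * φ x a) μ := hm.mul_of_top_left (hφ.memLp x)
  refine ⟨{ toFun := fun x => ∫ a, m a * φ x a ∂μ, map_add' := fun x y => ?_,
            map_smul' := fun c x => ?_ }, fun x => rfl⟩
  · rw [← integral_add (hint x) (hint y)]
    refine integral_congr_ae ?_
    filter_upwards [hφ.map_add x y] with a h
    rw [h]; ring
  · rw [RingHom.id_apply, smul_eq_mul, ← integral_const_mul]
    refine integral_congr_ae ?_
    filter_upwards [hφ.map_smul c x] with a h
    rw [h]; ring

end AELinear

/-- The function of two vectors `B` is bilinear: it is given by a bundled bilinear map. -/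
def IsBilinear (B : E → E' → ℝ) : Prop :=
  ∃ L : E →ₗ[ℝ] E' →ₗ[ℝ] ℝ, ∀ x y, L x y = B x y

namespace IsBilinear

variable {B B' : E → E' → ℝ}

lemma add (h : IsBilinear B) (h' : IsBilinear B') : IsBilinear fun x y => B x y + B' x y := by
  obtain ⟨L, hL⟩ := h
  obtain ⟨L', hL'⟩ := h'
  exact ⟨L + L', fun x y => by simp [hL, hL']⟩

lemma const_mul (h : IsBilinear B) (c : ℝ) : IsBilinear fun x y => c * B x y := by
  obtain ⟨L, hL⟩ := h
  exact ⟨c • L, fun x y => by simp [hL]⟩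

lemma sub (h : IsBilinear B) (h' : IsBilinear B') : IsBilinear fun x y => B x y - B' x y := by
  obtain ⟨L, hL⟩ := h
  obtain ⟨L', hL'⟩ := h'
  exact ⟨L - L', fun x y => by simp [hL, hL']⟩

lemma sum {ι : Type*} (s : Finset ι) {B : ι → E → E' → ℝ} (h : ∀ i ∈ s, IsBilinear (B i)) :
    IsBilinear fun x y => ∑ i ∈ s, B i x y := by
  classical
  choose! L hL using h
  refine ⟨∑ i ∈ s, L i, fun x y => ?_⟩
  simp only [LinearMap.sum_apply]
  exact Finset.sum_congr rfl fun i hi => hL i hi x y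

lemma of_integral [IsFiniteMeasure μ] {φ : E → α → ℝ} {ψ : E' → α → ℝ} (hφ : AELinear μ φ)
    (hψ : AELinear μ ψ) : IsBilinear fun x y => ∫ a, φ x a * ψ y a ∂μ := by
  have h1 (x : E) := hψ.exists_linearMap ((hφ.memLp x).integrable le_top)
  choose L hL using h1
  have h2 (y : E') := hφ.exists_linearMap ((hψ.memLp y).integrable le_top)
  choose L' hL' using h2
  have hswap (x : E) (y : E') : L x y = L' y x := by
    rw [hL, hL']; simp only [mul_comm]
  refine ⟨{ toFun := L, map_add' := fun x y => ?_, map_smul' := fun c x => ?_ }, hL⟩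
  · ext z; simp [hswap]
  · ext z; simp [hswap]

lemma of_integral_sum [IsFiniteMeasure μ] {ι : Type*} (s : Finset ι) {φ : ι → E → α → ℝ}
    {ψ : ι → E' → α → ℝ} (hφ : ∀ i ∈ s, AELinear μ (φ i)) (hψ : ∀ i ∈ s, AELinear μ (ψ i)) :
    IsBilinear fun x y => ∫ a, ∑ i ∈ s, φ i x a * ψ i y a ∂μ := by
  have h := sum s fun i hi => of_integral (hφ i hi) (hψ i hi)
  obtain ⟨L, hL⟩ := h
  refine ⟨L, fun x y => (hL x y).trans ?_⟩
  beta_reduce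
  rw [integral_finsetSum]
  exact fun i hi => (((hφ i hi).memLp x).mul_top ((hψ i hi).memLp y)).integrable le_top

end IsBilinear

end Bilinear

/-- A bilinear form that is positive on nonzero vectors of a finite-dimensional space represents
every linear functional uniquely. -/
lemma existsUnique_of_pos {E : Type*} [AddCommGroup E] [Module ℝ E] [FiniteDimensional ℝ E]
    (L : E →ₗ[ℝ] E →ₗ[ℝ] ℝ) (hpos : ∀ x, L x x ≤ 0 → x = 0) (F : E →ₗ[ℝ] ℝ) :
    ∃! x, ∀ y, L x y = F y := by
  have hinj : Function.Injective L := by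
    rw [← LinearMap.ker_eq_bot, LinearMap.ker_eq_bot']
    intro x hx
    exact hpos x (by rw [hx]; simp)
  have hsurj : Function.Surjective L :=
    (LinearMap.injective_iff_surjective_of_finrank_eq_finrank
      (Subspace.dual_finrank_eq (K := ℝ) (V := E)).symm).1 hinj
  obtain ⟨x, hx⟩ := hsurj F
  exact ⟨x, fun y => by rw [hx], fun z hz => hinj (LinearMap.ext fun y => by rw [hz, hx])⟩

/-! ### Derivatives of finite element functions -/

section Derivatives

variable {d : ℕ} {Ω : Set (Euc d)} {K : Geometry.SimplicialComplex ℝ (Euc d)} {k : ℕ}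
  {t : Finset (Euc d)}

lemma interior_cell_nonempty (ht : t ∈ elements K) : (interior (cell t)).Nonempty := by
  rw [interior_convexHull_nonempty_iff_affineSpan_eq_top]
  have h1 := (K.indep ht.1).affineSpan_eq_top_iff_card_eq_finrank_add_one.2
    (by simpa using ht.2)
  rwa [Subtype.range_coe] at h1

lemma uniqueDiffOn_cell (ht : t ∈ elements K) : UniqueDiffOn ℝ (cell t) :=
  uniqueDiffOn_convex (convex_convexHull ℝ _) (interior_cell_nonempty ht)

lemma inner_single_eq (x : Euc d) (i : Fin d) :
    inner ℝ x (EuclideanSpace.single i (1 : ℝ)) = x i := by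
  simp [EuclideanSpace.inner_single_right]

lemma gradElem_apply_eq (ht : t ∈ elements K) {q : Euc d → ℝ} {P : MvPolynomial (Fin d) ℝ}
    (hq : ∀ x ∈ cell t, q x = polyEval P x) {x : Euc d} (hx : x ∈ cell t) (i : Fin d) :
    gradElem t q x i = polyEval (MvPolynomial.pderiv i P) x := by
  have h : HasFDerivWithinAt q _ (cell t) x :=
    ((hasFDerivAt_polyEval P x).hasFDerivWithinAt).congr hq (hq x hx)
  rw [← inner_single_eq, gradElem, gradientWithin, InnerProductSpace.toDual_symm_apply,
    h.fderivWithin (uniqueDiffOn_cell ht x hx)]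
  simp

lemma jacElem_apply_eq (ht : t ∈ elements K) {v : Euc d → Euc d}
    {P : Fin d → MvPolynomial (Fin d) ℝ} (hv : ∀ i, ∀ x ∈ cell t, v x i = polyEval (P i) x)
    {x : Euc d} (hx : x ∈ cell t) (i j : Fin d) :
    jacElem t v x i j = polyEval (MvPolynomial.pderiv j (P i)) x := by
  have hi (i : Fin d) : HasFDerivWithinAt (fun y => v y i) _ (cell t) x :=
    ((hasFDerivAt_polyEval (P i) x).hasFDerivWithinAt).congr (hv i) (hv i x hx)
  have hdiff : DifferentiableWithinAt ℝ v (cell t) x :=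
    (differentiableWithinAt_euclidean).2 fun i => (hi i).differentiableWithinAt
  have h2 : HasFDerivWithinAt (fun y => v y i)
      ((EuclideanSpace.proj i : Euc d →L[ℝ] ℝ).comp (fderivWithin ℝ v (cell t) x)) (cell t) x :=
    (EuclideanSpace.proj i : Euc d →L[ℝ] ℝ).hasFDerivAt.comp_hasFDerivWithinAt x
      hdiff.hasFDerivWithinAt
  have h3 := (uniqueDiffOn_cell ht x hx).eq h2 (hi i)
  have h4 := congrArg (fun L : Euc d →L[ℝ] ℝ => L (EuclideanSpace.single j 1)) h3
  simp only [ContinuousLinearMap.comp_apply] at h4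
  refine (show jacElem t v x i j = _ from h4).trans ?_
  simp

lemma gradient_eq_gradElem (q : Euc d → ℝ) {x : Euc d} (hx : x ∈ interior (cell t)) :
    gradient q x = gradElem t q x := by
  rw [gradElem, gradient, gradientWithin,
    fderivWithin_of_mem_nhds (mem_interior_iff_mem_nhds.1 hx)]

lemma jac_eq_jacElem (v : Euc d → Euc d) {x : Euc d} (hx : x ∈ interior (cell t)) :
    jac v x = jacElem t v x := by
  rw [jac, jacElem, fderivWithin_of_mem_nhds (mem_interior_iff_mem_nhds.1 hx)]

lemma measurable_jac (v : Euc d → Euc d) (i j : Fin d) : Measurable fun x => jac v x i j := by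
  have h : Measurable fun x => fderiv ℝ v x (EuclideanSpace.single j 1) :=
    measurable_fderiv_apply_const ℝ v _
  exact (EuclideanSpace.proj i : Euc d →L[ℝ] ℝ).continuous.measurable.comp h

lemma measurable_gradient (q : Euc d → ℝ) (i : Fin d) : Measurable fun x => gradient q x i := by
  have h : Measurable fun x => fderiv ℝ q x (EuclideanSpace.single i 1) :=
    measurable_fderiv_apply_const ℝ q _
  convert! h using 2 with x
  rw [← inner_single_eq, gradient, InnerProductSpace.toDual_symm_apply]

/-- Functions that are polynomials in the interior of each element are essentially bounded. -/
lemma IsTriangulation.memLp_top (hΩ : IsLipschitzDomain Ω) (hK : IsTriangulation Ω K)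
    {f : Euc d → ℝ} (hf : AEStronglyMeasurable f (volume.restrict Ω))
    (hP : ∀ t ∈ elements K, ∃ P : MvPolynomial (Fin d) ℝ,
      ∀ x ∈ interior (cell t), f x = polyEval P x) : MemLp f ⊤ (volume.restrict Ω) := by
  choose! P hP using hP
  have hb (t : Finset (Euc d)) : ∃ C, ∀ x ∈ cell t, ‖polyEval (P t) x‖ ≤ C :=
    (isCompact_cell t).exists_bound_of_continuousOn (continuous_polyEval _).continuousOn
  choose C hC using hb
  obtain ⟨M, hM⟩ := (hK.finite_elements.image C).bddAbove
  refine memLp_top_of_bound hf M ?_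
  filter_upwards [hK.ae_exists_mem_interior hΩ] with x ⟨t, ht, hx⟩
  rw [hP t ht x hx]
  exact (hC t x (interior_subset hx)).trans (hM (mem_image_of_mem _ ht))

lemma IsPiecewisePoly.memLp_top (hΩ : IsLipschitzDomain Ω) (hK : IsTriangulation Ω K)
    {q : Euc d → ℝ} (hc : ContinuousOn q (closure Ω)) (hq : IsPiecewisePoly K k q) :
    MemLp q ⊤ (volume.restrict Ω) := by
  refine hK.memLp_top hΩ ((hc.mono subset_closure).aestronglyMeasurable hΩ.isOpen.measurableSet)
    fun t ht => ?_
  obtain ⟨P, -, hP⟩ := hq t ht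
  exact ⟨P, fun x hx => hP x (interior_subset hx)⟩

lemma IsPiecewisePoly.memLp_gradient (hΩ : IsLipschitzDomain Ω) (hK : IsTriangulation Ω K)
    {q : Euc d → ℝ} (hq : IsPiecewisePoly K k q) (i : Fin d) :
    MemLp (fun x => gradient q x i) ⊤ (volume.restrict Ω) := by
  refine hK.memLp_top hΩ (measurable_gradient q i).aestronglyMeasurable fun t ht => ?_
  obtain ⟨P, -, hP⟩ := hq t ht
  refine ⟨MvPolynomial.pderiv i P, fun x hx => ?_⟩
  rw [gradient_eq_gradElem q hx, gradElem_apply_eq ht hP (interior_subset hx)]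

lemma memLp_jac (hΩ : IsLipschitzDomain Ω) (hK : IsTriangulation Ω K)
    {v : Euc d → Euc d} (hv : ∀ i, IsPiecewisePoly K k fun x => v x i) (i j : Fin d) :
    MemLp (fun x => jac v x i j) ⊤ (volume.restrict Ω) := by
  refine hK.memLp_top hΩ (measurable_jac v i j).aestronglyMeasurable fun t ht => ?_
  choose P hP using fun i => hv i t ht
  refine ⟨MvPolynomial.pderiv j (P i), fun x hx => ?_⟩
  rw [jac_eq_jacElem v hx, jacElem_apply_eq ht (fun i => (hP i).2) (interior_subset hx)]

lemma gradElem_add (ht : t ∈ elements K) {p q : Euc d → ℝ} (hp : IsPiecewisePoly K k p)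
    (hq : IsPiecewisePoly K k q) {x : Euc d} (hx : x ∈ cell t) (i : Fin d) :
    gradElem t (p + q) x i = gradElem t p x i + gradElem t q x i := by
  obtain ⟨P, -, hP⟩ := hp t ht
  obtain ⟨Q, -, hQ⟩ := hq t ht
  have h : ∀ x ∈ cell t, (p + q) x = polyEval (P + Q) x := fun x hx => by
    simp [polyEval, hP x hx, hQ x hx]
  rw [gradElem_apply_eq ht hP hx, gradElem_apply_eq ht hQ hx, gradElem_apply_eq ht h hx]
  simp [polyEval]

lemma gradElem_smul (ht : t ∈ elements K) {q : Euc d → ℝ} (hq : IsPiecewisePoly K k q) (c : ℝ)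
    {x : Euc d} (hx : x ∈ cell t) (i : Fin d) :
    gradElem t (c • q) x i = c * gradElem t q x i := by
  obtain ⟨Q, -, hQ⟩ := hq t ht
  have h : ∀ x ∈ cell t, (c • q) x = polyEval (c • Q) x := fun x hx => by
    simp [polyEval, hQ x hx]
  rw [gradElem_apply_eq ht hQ hx, gradElem_apply_eq ht h hx]
  simp [polyEval]

lemma jacElem_add (ht : t ∈ elements K) {v w : Euc d → Euc d}
    (hv : ∀ i, IsPiecewisePoly K k fun x => v x i) (hw : ∀ i, IsPiecewisePoly K k fun x => w x i)
    {x : Euc d} (hx : x ∈ cell t) (i j : Fin d) :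
    jacElem t (v + w) x i j = jacElem t v x i j + jacElem t w x i j := by
  choose P hP using fun i => hv i t ht
  choose Q hQ using fun i => hw i t ht
  have h : ∀ i, ∀ x ∈ cell t, (v + w) x i = polyEval (P i + Q i) x := fun i x hx => by
    simp [polyEval, (hP i).2 x hx, (hQ i).2 x hx]
  rw [jacElem_apply_eq ht (fun i => (hP i).2) hx, jacElem_apply_eq ht (fun i => (hQ i).2) hx,
    jacElem_apply_eq (P := fun i => P i + Q i) ht h hx]
  simp [polyEval]

lemma jacElem_smul (ht : t ∈ elements K) {v : Euc d → Euc d}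
    (hv : ∀ i, IsPiecewisePoly K k fun x => v x i) (c : ℝ) {x : Euc d} (hx : x ∈ cell t)
    (i j : Fin d) : jacElem t (c • v) x i j = c * jacElem t v x i j := by
  choose P hP using fun i => hv i t ht
  have h : ∀ i, ∀ x ∈ cell t, (c • v) x i = polyEval (c • P i) x := fun i x hx => by
    simp [polyEval, (hP i).2 x hx]
  rw [jacElem_apply_eq ht (fun i => (hP i).2) hx,
    jacElem_apply_eq (P := fun i => c • P i) ht h hx]
  simp [polyEval]

end Derivatives

/-! ### Linear dependence of the integrands on the finite element functions -/

section AELinear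

variable {d : ℕ} {Ω : Set (Euc d)} {K : Geometry.SimplicialComplex ℝ (Euc d)} {k : ℕ}
  {X : Submodule ℝ (Euc d → Euc d)} {Y : Submodule ℝ (Euc d → ℝ)}

lemma aeLinear_velocity (hΩ : IsLipschitzDomain Ω) (hK : IsTriangulation Ω K)
    (hX : ∀ v ∈ X, IsDiscreteVelocity Ω K k v) (i : Fin d) :
    AELinear (volume.restrict Ω) fun (v : X) x => (v : Euc d → Euc d) x i where
  memLp v := ((hX v v.2).piecewisePoly i).memLp_top hΩ hK
    ((EuclideanSpace.proj i : Euc d →L[ℝ] ℝ).continuous.comp_continuousOn (hX v v.2).continuousOn)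
  map_add v w := by simp
  map_smul c v := by simp

lemma aeLinear_jac (hΩ : IsLipschitzDomain Ω) (hK : IsTriangulation Ω K)
    (hX : ∀ v ∈ X, IsDiscreteVelocity Ω K k v) (i j : Fin d) :
    AELinear (volume.restrict Ω) fun (v : X) x => jac (v : Euc d → Euc d) x i j where
  memLp v := memLp_jac hΩ hK (hX v v.2).piecewisePoly i j
  map_add v w := by
    filter_upwards [hK.ae_exists_mem_interior hΩ] with x ⟨t, ht, hx⟩
    rw [jac_eq_jacElem _ hx, jac_eq_jacElem _ hx, jac_eq_jacElem _ hx, Submodule.coe_add,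
      jacElem_add ht (hX v v.2).piecewisePoly (hX w w.2).piecewisePoly (interior_subset hx)]
  map_smul c v := by
    filter_upwards [hK.ae_exists_mem_interior hΩ] with x ⟨t, ht, hx⟩
    rw [jac_eq_jacElem _ hx, jac_eq_jacElem _ hx, Submodule.coe_smul,
      jacElem_smul ht (hX v v.2).piecewisePoly c (interior_subset hx)]

lemma aeLinear_pressure (hΩ : IsLipschitzDomain Ω) (hK : IsTriangulation Ω K)
    (hY : ∀ q ∈ Y, IsDiscretePressure Ω K k q) :
    AELinear (volume.restrict Ω) fun (q : Y) x => (q : Euc d → ℝ) x where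
  memLp q := (hY q q.2).piecewisePoly.memLp_top hΩ hK (hY q q.2).continuousOn
  map_add v w := by simp
  map_smul c v := by simp

lemma aeLinear_gradient (hΩ : IsLipschitzDomain Ω) (hK : IsTriangulation Ω K)
    (hY : ∀ q ∈ Y, IsDiscretePressure Ω K k q) (i : Fin d) :
    AELinear (volume.restrict Ω) fun (q : Y) x => gradient (q : Euc d → ℝ) x i where
  memLp q := (hY q q.2).piecewisePoly.memLp_gradient hΩ hK i
  map_add v w := by
    filter_upwards [hK.ae_exists_mem_interior hΩ] with x ⟨t, ht, hx⟩
    rw [gradient_eq_gradElem _ hx, gradient_eq_gradElem _ hx, gradient_eq_gradElem _ hx,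
      Submodule.coe_add,
      gradElem_add ht (hY v v.2).piecewisePoly (hY w w.2).piecewisePoly (interior_subset hx)]
  map_smul c v := by
    filter_upwards [hK.ae_exists_mem_interior hΩ] with x ⟨t, ht, hx⟩
    rw [gradient_eq_gradElem _ hx, gradient_eq_gradElem _ hx, Submodule.coe_smul,
      gradElem_smul ht (hY v v.2).piecewisePoly c (interior_subset hx)]

lemma memLp_top_restrict_of_continuousOn {μ : Measure (Euc d)} {F : Set (Euc d)} (hF : IsCompact F)
    {f : Euc d → ℝ} (hf : ContinuousOn f F) : MemLp f ⊤ (μ.restrict F) := by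
  obtain ⟨C, hC⟩ := hF.exists_bound_of_continuousOn hf
  refine memLp_top_of_bound (hf.aestronglyMeasurable hF.measurableSet) C ?_
  exact ae_restrict_of_forall_mem hF.measurableSet hC

lemma aeLinear_gradElem {μ : Measure (Euc d)} {t : Finset (Euc d)} (ht : t ∈ elements K)
    {F : Set (Euc d)} (hF : IsCompact F) (hFt : F ⊆ cell t)
    (hY : ∀ q ∈ Y, IsDiscretePressure Ω K k q) (i : Fin d) :
    AELinear (μ.restrict F) fun (q : Y) x => gradElem t (q : Euc d → ℝ) x i where
  memLp q := by
    obtain ⟨P, -, hP⟩ := (hY q q.2).piecewisePoly t ht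
    refine memLp_top_restrict_of_continuousOn hF
      ((continuous_polyEval (MvPolynomial.pderiv i P)).continuousOn.congr fun x hx => ?_)
    exact gradElem_apply_eq ht hP (hFt hx) i
  map_add p q := ae_restrict_of_forall_mem hF.measurableSet fun x hx =>
    gradElem_add ht (hY p p.2).piecewisePoly (hY q q.2).piecewisePoly (hFt hx) i
  map_smul c q := ae_restrict_of_forall_mem hF.measurableSet fun x hx =>
    gradElem_smul ht (hY q q.2).piecewisePoly c (hFt hx) i

lemma aeLinear_jacElem {μ : Measure (Euc d)} {t : Finset (Euc d)} (ht : t ∈ elements K)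
    {F : Set (Euc d)} (hF : IsCompact F) (hFt : F ⊆ cell t)
    (hX : ∀ v ∈ X, IsDiscreteVelocity Ω K k v) (i j : Fin d) :
    AELinear (μ.restrict F) fun (v : X) x => jacElem t (v : Euc d → Euc d) x i j where
  memLp v := by
    choose P hP using fun i => (hX v v.2).piecewisePoly i t ht
    refine memLp_top_restrict_of_continuousOn hF
      ((continuous_polyEval (MvPolynomial.pderiv j (P i))).continuousOn.congr fun x hx => ?_)
    exact jacElem_apply_eq ht (fun i => (hP i).2) (hFt hx) i j
  map_add v w := ae_restrict_of_forall_mem hF.measurableSet fun x hx =>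
    jacElem_add ht (hX v v.2).piecewisePoly (hX w w.2).piecewisePoly (hFt hx) i j
  map_smul c v := ae_restrict_of_forall_mem hF.measurableSet fun x hx =>
    jacElem_smul ht (hX v v.2).piecewisePoly c (hFt hx) i j

end AELinear

/-! ### The inverse trace inequality -/

lemma crossDotCurl_sq_le (d : ℕ) (a b : Fin d → ℝ) (J : Matrix (Fin d) (Fin d) ℝ) :
    crossDotCurl d a b J ^ 2 ≤ 2 * (∑ i, a i ^ 2) * (∑ i, b i ^ 2) * ∑ i, ∑ j, J i j ^ 2 := by
  match d, a, b, J with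
  | 2, a, b, J =>
    simp only [crossDotCurl, Fin.sum_univ_two]
    have h1 : (a 0 * b 1 - a 1 * b 0) ^ 2 ≤ (a 0 ^ 2 + a 1 ^ 2) * (b 0 ^ 2 + b 1 ^ 2) := by
      nlinarith [sq_nonneg (a 0 * b 0 + a 1 * b 1)]
    have h2 : (J 1 0 - J 0 1) ^ 2 ≤ 2 * (J 0 0 ^ 2 + J 0 1 ^ 2 + (J 1 0 ^ 2 + J 1 1 ^ 2)) := by
      nlinarith [sq_nonneg (J 1 0 + J 0 1), sq_nonneg (J 0 0), sq_nonneg (J 1 1)]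
    rw [mul_pow]
    refine (mul_le_mul h1 h2 (sq_nonneg _) (by positivity)).trans_eq (by ring)
  | 3, a, b, J =>
    simp only [crossDotCurl, Fin.sum_univ_three, cross_apply, Matrix.vec3_dotProduct,
      Matrix.cons_val_zero, Matrix.cons_val_one, Matrix.cons_val]
    set x := a 1 * b 2 - a 2 * b 1 with hx
    set y := a 2 * b 0 - a 0 * b 2 with hy
    set z := a 0 * b 1 - a 1 * b 0 with hz
    have h1 : x ^ 2 + y ^ 2 + z ^ 2 ≤
        (a 0 ^ 2 + a 1 ^ 2 + a 2 ^ 2) * (b 0 ^ 2 + b 1 ^ 2 + b 2 ^ 2) := by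
      rw [hx, hy, hz]
      nlinarith [sq_nonneg (a 0 * b 0 + a 1 * b 1 + a 2 * b 2)]
    have h2 : (J 2 1 - J 1 2) ^ 2 + (J 0 2 - J 2 0) ^ 2 + (J 1 0 - J 0 1) ^ 2 ≤
        2 * (J 0 0 ^ 2 + J 0 1 ^ 2 + J 0 2 ^ 2 + (J 1 0 ^ 2 + J 1 1 ^ 2 + J 1 2 ^ 2)
          + (J 2 0 ^ 2 + J 2 1 ^ 2 + J 2 2 ^ 2)) := by
      nlinarith [sq_nonneg (J 2 1 + J 1 2), sq_nonneg (J 0 2 + J 2 0), sq_nonneg (J 1 0 + J 0 1),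
        sq_nonneg (J 0 0), sq_nonneg (J 1 1), sq_nonneg (J 2 2)]
    have h3 (p q r : ℝ) : (x * p + y * q + z * r) ^ 2 ≤
        (x ^ 2 + y ^ 2 + z ^ 2) * (p ^ 2 + q ^ 2 + r ^ 2) := by
      nlinarith [sq_nonneg (x * q - y * p), sq_nonneg (x * r - z * p), sq_nonneg (y * r - z * q)]
    refine (h3 _ _ _).trans ?_
    refine (mul_le_mul h1 h2 (by positivity) (by positivity)).trans_eq (by ring)
  | 0, _, _, _ => simp [crossDotCurl]
  | 1, a, b, J =>
    simp only [crossDotCurl]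
    rw [zero_pow two_ne_zero]
    positivity
  | n + 4, a, b, J =>
    simp only [crossDotCurl]
    rw [zero_pow two_ne_zero]
    positivity

section Trace

variable {d : ℕ} {Ω : Set (Euc d)} {K : Geometry.SimplicialComplex ℝ (Euc d)} {k : ℕ}
  {t : Finset (Euc d)}

lemma norm_outwardNormal_sq_le [DecidableEq (Euc d)] (t : Finset (Euc d)) (a : Euc d) :
    ∑ i, (outwardNormal t a).ofLp i ^ 2 ≤ 1 := by
  rw [← EuclideanSpace.real_norm_sq_eq, outwardNormal]
  refine pow_le_one₀ (norm_nonneg _) ?_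
  rw [norm_smul, norm_inv, norm_norm]
  exact inv_mul_le_one

lemma IsShapeRegular.elementSize_pos {κ : ℝ} (hd : 0 < d) (hS : IsShapeRegular K κ)
    (ht : t ∈ elements K) : 0 < elementSize t := by
  obtain ⟨c, r, hr, hball, -⟩ := hS t ht
  have h1 : c + EuclideanSpace.single (⟨0, hd⟩ : Fin d) r ∈ Metric.closedBall c r := by
    simp [abs_of_pos hr]
  have h2 : c ∈ Metric.closedBall c r := Metric.mem_closedBall_self hr.le
  have h3 := Metric.dist_le_diam_of_mem (isCompact_cell t).isBounded (hball h1) (hball h2)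
  have h4 : dist (c + EuclideanSpace.single (⟨0, hd⟩ : Fin d) r) c = r := by
    simp [abs_of_pos hr]
  exact hr.trans_le (h4 ▸ h3)

lemma integrableOn_cell_polyEval_sq (P : MvPolynomial (Fin d) ℝ) (t : Finset (Euc d)) :
    IntegrableOn (fun x => polyEval P x ^ 2) (cell t) :=
  ((continuous_polyEval P).pow 2).continuousOn.integrableOn_compact (isCompact_cell t)

/-- An element of size `h` contains a ball of radius proportional to `h`, and is contained in a
concentric ball of proportional radius; hence polynomials are bounded on it by `h^(-d/2)` times
their `L²` norm. -/
lemma exists_sq_le_integral_cell (d k : ℕ) (hd : 0 < d) (κ : ℝ) (hκ : 0 < κ) :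
    ∃ C : ℝ, 0 < C ∧ ∀ K : Geometry.SimplicialComplex ℝ (Euc d), IsShapeRegular K κ →
      ∀ t ∈ elements K, ∀ P : MvPolynomial (Fin d) ℝ, P.totalDegree ≤ k → ∀ x ∈ cell t,
        polyEval P x ^ 2 ≤ C * (elementSize t ^ d)⁻¹ * ∫ y in cell t, polyEval P y ^ 2 := by
  obtain ⟨C, hC, h⟩ := exists_sq_le_integral_ball d k (2 * κ)
  refine ⟨C * (2 * κ) ^ d, by positivity, fun K hS t ht P hP x hx => ?_⟩
  have hpos := hS.elementSize_pos hd ht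
  obtain ⟨c, r, hr, hball, hsize⟩ := hS t ht
  have hc : c ∈ cell t := hball (Metric.mem_closedBall_self hr.le)
  have hsize' : elementSize t ≤ 2 * κ * r := by linarith
  have h1 := h P hP c r hr x
    (Metric.closedBall_subset_closedBall hsize' (cell_subset_closedBall t hc hx))
  have h2 : ∫ y in Metric.ball c r, polyEval P y ^ 2 ≤ ∫ y in cell t, polyEval P y ^ 2 :=
    setIntegral_mono_set (integrableOn_cell_polyEval_sq P t)
      (Filter.Eventually.of_forall fun y => sq_nonneg _)
      (Metric.ball_subset_closedBall.trans hball).eventuallyLE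
  have h3 : (r ^ d)⁻¹ ≤ (2 * κ) ^ d * (elementSize t ^ d)⁻¹ := by
    rw [← div_eq_mul_inv, le_div_iff₀ (by positivity), inv_mul_le_iff₀ (by positivity), ← mul_pow]
    exact pow_le_pow_left₀ hpos.le (by linarith) d
  have h4 : 0 ≤ ∫ y in Metric.ball c r, polyEval P y ^ 2 := integral_nonneg fun y => sq_nonneg _
  calc polyEval P x ^ 2 ≤ C * (r ^ d)⁻¹ * ∫ y in Metric.ball c r, polyEval P y ^ 2 := h1
    _ ≤ C * ((2 * κ) ^ d * (elementSize t ^ d)⁻¹) * ∫ y in cell t, polyEval P y ^ 2 := by gcongr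
    _ = _ := by ring

/-- The squared Frobenius norm of the velocity gradient. -/
noncomputable def jacSq (v : Euc d → Euc d) (x : Euc d) : ℝ := ∑ i, ∑ j, jac v x i j ^ 2

lemma jacSq_nonneg (v : Euc d → Euc d) (x : Euc d) : 0 ≤ jacSq v x := by
  unfold jacSq; positivity

lemma sq_jac_le_jacSq (v : Euc d → Euc d) (x : Euc d) (i j : Fin d) : jac v x i j ^ 2 ≤ jacSq v x :=
  (Finset.single_le_sum (f := fun j => jac v x i j ^ 2) (fun _ _ => sq_nonneg _)
    (Finset.mem_univ j)).trans
    (Finset.single_le_sum (f := fun i => ∑ j, jac v x i j ^ 2)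
      (fun _ _ => Finset.sum_nonneg fun _ _ => sq_nonneg _) (Finset.mem_univ i))

lemma setIntegral_gradient_sq (ht : t ∈ elements K) {q : Euc d → ℝ} {P : MvPolynomial (Fin d) ℝ}
    (hq : ∀ x ∈ cell t, q x = polyEval P x) :
    ∫ x in cell t, ‖gradient q x‖ ^ 2 =
      ∑ i, ∫ x in cell t, polyEval (MvPolynomial.pderiv i P) x ^ 2 := by
  rw [← integral_finsetSum _ fun i _ => integrableOn_cell_polyEval_sq _ t]
  refine setIntegral_congr_ae (measurableSet_cell t) ?_
  filter_upwards [ae_mem_interior_of_mem_cell t] with x hx hxt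
  rw [EuclideanSpace.real_norm_sq_eq]
  refine Finset.sum_congr rfl fun i _ => ?_
  rw [gradient_eq_gradElem q (hx hxt), gradElem_apply_eq ht hq hxt]

lemma setIntegral_jacSq (ht : t ∈ elements K) {v : Euc d → Euc d}
    {P : Fin d → MvPolynomial (Fin d) ℝ} (hv : ∀ i, ∀ x ∈ cell t, v x i = polyEval (P i) x) :
    ∫ x in cell t, jacSq v x =
      ∑ i, ∑ j, ∫ x in cell t, polyEval (MvPolynomial.pderiv j (P i)) x ^ 2 := by
  simp_rw [← integral_finsetSum _ fun j _ => integrableOn_cell_polyEval_sq _ t]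
  rw [← integral_finsetSum _ fun i _ =>
    integrable_finsetSum _ fun j _ => integrableOn_cell_polyEval_sq _ t]
  refine setIntegral_congr_ae (measurableSet_cell t) ?_
  filter_upwards [ae_mem_interior_of_mem_cell t] with x hx hxt
  refine Finset.sum_congr rfl fun i _ => Finset.sum_congr rfl fun j _ => ?_
  rw [jac_eq_jacElem v (hx hxt), jacElem_apply_eq ht hv hxt]

open Classical in
/-- The boundary contribution of a single element is bounded by `νmax / h_e` times the `L²` norms of
the gradients on that element. -/
lemma exists_element_boundary_le (d k : ℕ) (hd : 2 ≤ d) (κ : ℝ) (hκ : 0 < κ) :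
    ∃ C : ℝ, 0 < C ∧ ∀ (Ω : Set (Euc d)) (K : Geometry.SimplicialComplex ℝ (Euc d)),
      IsTriangulation Ω K → IsShapeRegular K κ →
      ∀ (ν : Euc d → ℝ) (νmax : ℝ), (∀ x ∈ closure Ω, |ν x| ≤ νmax) → 0 ≤ νmax →
      ∀ (v : Euc d → Euc d) (q : Euc d → ℝ), (∀ i, IsPiecewisePoly K k fun x => v x i) →
        IsPiecewisePoly K k q → ∀ t ∈ elements K,
        |∑ a ∈ t with convexHull ℝ ((t.erase a : Finset (Euc d)) : Set (Euc d)) ⊆ frontier Ω,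
          ∫ x in convexHull ℝ ((t.erase a : Finset (Euc d)) : Set (Euc d)),
            ν x * crossDotCurl d (gradElem t q x).ofLp (outwardNormal t a).ofLp (jacElem t v x)
              ∂(μHE[d - 1] : Measure (Euc d))| ≤
        C * νmax / elementSize t *
          (√(∫ x in cell t, ‖gradient q x‖ ^ 2) * √(∫ x in cell t, jacSq v x)) := by
  obtain ⟨A, hA, hpoly⟩ := exists_sq_le_integral_cell d k (by omega) κ hκ
  set c := (volume : Measure (Euc (d - 1))).real (Metric.closedBall 0 1)
  have hc : 0 ≤ c := measureReal_nonneg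
  refine ⟨(d + 1) * (√2 * A) * c + 1, by positivity, ?_⟩
  intro Ω K hK hS ν νmax hν hνmax v q hv hq t ht
  have hpos := hS.elementSize_pos (by omega) ht
  obtain ⟨P, hPk, hP⟩ := hq t ht
  choose R hR using fun i => hv i t ht
  set h := elementSize t
  set E := ∫ x in cell t, ‖gradient q x‖ ^ 2 with hE
  set D := ∫ x in cell t, jacSq v x with hD
  have hE0 : 0 ≤ E := integral_nonneg fun x => by positivity
  have hD0 : 0 ≤ D := integral_nonneg fun x => jacSq_nonneg v x
  have hgrad : ∀ x ∈ cell t, ∑ i, gradElem t q x i ^ 2 ≤ A * (h ^ d)⁻¹ * E := fun x hx => by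
    rw [hE, setIntegral_gradient_sq ht hP, Finset.mul_sum]
    refine Finset.sum_le_sum fun i _ => ?_
    rw [gradElem_apply_eq ht hP hx]
    exact hpoly K hS t ht _ ((totalDegree_pderiv_le i P).trans hPk) x hx
  have hjac : ∀ x ∈ cell t, ∑ i, ∑ j, jacElem t v x i j ^ 2 ≤ A * (h ^ d)⁻¹ * D := fun x hx => by
    rw [hD, setIntegral_jacSq ht (fun i => (hR i).2), Finset.mul_sum]
    refine Finset.sum_le_sum fun i _ => ?_
    rw [Finset.mul_sum]
    refine Finset.sum_le_sum fun j _ => ?_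
    rw [jacElem_apply_eq ht (fun i => (hR i).2) hx]
    exact hpoly K hS t ht _ ((totalDegree_pderiv_le j _).trans (hR i).1) x hx
  -- A pointwise bound of the integrand that is constant on the element, so that only the measure of
  -- the face, of order `h^(d-1)`, enters.
  set M := νmax * (√2 * (A * (h ^ d)⁻¹) * (√E * √D)) with hM
  have hM0 : 0 ≤ M := by positivity
  have hpt : ∀ a, ∀ x ∈ cell t, ‖ν x * crossDotCurl d (gradElem t q x).ofLp
      (outwardNormal t a).ofLp (jacElem t v x)‖ ≤ M := fun a x hx => by
    rw [norm_mul, Real.norm_eq_abs, Real.norm_eq_abs]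
    refine mul_le_mul (hν x (hK.cell_subset ht hx)) ?_ (abs_nonneg _) hνmax
    refine abs_le_of_sq_le_sq ?_ (by positivity)
    refine (crossDotCurl_sq_le _ _ _ _).trans ?_
    calc _ ≤ 2 * (A * (h ^ d)⁻¹ * E) * 1 * (A * (h ^ d)⁻¹ * D) := by
          have h1 := hgrad x hx
          have h2 := hjac x hx
          have h3 := norm_outwardNormal_sq_le t a
          gcongr
      _ = (√2 * (A * (h ^ d)⁻¹) * (√E * √D)) ^ 2 := by
          simp only [mul_pow, Real.sq_sqrt hE0, Real.sq_sqrt hD0,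
            Real.sq_sqrt (zero_le_two : (0 : ℝ) ≤ 2)]
          ring
  refine (Finset.abs_sum_le_sum_abs _ _).trans ?_
  have hface : ∀ a ∈ t, |∫ x in convexHull ℝ ((t.erase a : Finset (Euc d)) : Set (Euc d)),
      ν x * crossDotCurl d (gradElem t q x).ofLp (outwardNormal t a).ofLp (jacElem t v x)
        ∂(μHE[d - 1] : Measure (Euc d))| ≤ M * (c * h ^ (d - 1)) := fun a ha => by
    obtain ⟨hfin, hle⟩ := measureReal_face_le hd ht ha
    have hsub : cell (t.erase a) ⊆ cell t := convexHull_mono (by simp)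
    refine (norm_setIntegral_le_of_norm_le_const hfin fun x hx => hpt a x (hsub hx)).trans ?_
    exact mul_le_mul_of_nonneg_left hle hM0
  refine (Finset.sum_le_card_nsmul _ _ (M * (c * h ^ (d - 1)))
    fun a ha => hface a (Finset.mem_filter.1 ha).1).trans ?_
  have hcard : ((t.filter fun a => convexHull ℝ ((t.erase a : Finset (Euc d)) : Set (Euc d)) ⊆
      frontier Ω).card : ℝ) ≤ d + 1 := by
    have := (Finset.card_filter_le t fun a =>
      convexHull ℝ ((t.erase a : Finset (Euc d)) : Set (Euc d)) ⊆ frontier Ω).trans_eq ht.2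
    exact_mod_cast this
  rw [nsmul_eq_mul]
  have hpow : (h ^ d)⁻¹ * h ^ (d - 1) = h⁻¹ := by
    obtain ⟨m, rfl⟩ : ∃ m, d = m + 1 := ⟨d - 1, by omega⟩
    rw [Nat.add_sub_cancel, pow_succ]
    field_simp
  calc _ ≤ ((d : ℝ) + 1) * (M * (c * h ^ (d - 1))) := by gcongr
    _ = (d + 1) * (√2 * A) * c * νmax * ((h ^ d)⁻¹ * h ^ (d - 1)) * (√E * √D) := by rw [hM]; ring
    _ = (d + 1) * (√2 * A) * c * νmax * h⁻¹ * (√E * √D) := by rw [hpow]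
    _ ≤ ((d + 1) * (√2 * A) * c + 1) * νmax * h⁻¹ * (√E * √D) := by gcongr; linarith
    _ = _ := by ring

lemma meshSize_pos (hd : 0 < d) {κ : ℝ} (hK : IsTriangulation Ω K) (hS : IsShapeRegular K κ)
    (ht : t ∈ elements K) : 0 < meshSize K :=
  (hS.elementSize_pos hd ht).trans_le
    (le_csSup (hK.finite_elements.image _).bddAbove (mem_image_of_mem _ ht))

lemma integrable_gradient_sq (hΩ : IsLipschitzDomain Ω) (hK : IsTriangulation Ω K)
    {q : Euc d → ℝ} (hq : IsPiecewisePoly K k q) :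
    Integrable (fun x => ‖gradient q x‖ ^ 2) (volume.restrict Ω) := by
  have := hΩ.isFiniteMeasure
  simp only [EuclideanSpace.real_norm_sq_eq]
  simp only [sq]
  exact integrable_finsetSum _ fun i _ =>
    ((hq.memLp_gradient hΩ hK i).mul_top (hq.memLp_gradient hΩ hK i)).integrable le_top

lemma integrable_jacSq (hΩ : IsLipschitzDomain Ω) (hK : IsTriangulation Ω K)
    {v : Euc d → Euc d} (hv : ∀ i, IsPiecewisePoly K k fun x => v x i) :
    Integrable (jacSq v) (volume.restrict Ω) := by
  have := hΩ.isFiniteMeasure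
  unfold jacSq
  simp only [sq]
  exact integrable_finsetSum _ fun i _ => integrable_finsetSum _ fun j _ =>
    ((memLp_jac hΩ hK hv i j).mul_top (memLp_jac hΩ hK hv i j)).integrable le_top

/-- The boundary term is controlled by the gradients in the interior. Young's inequality puts the
whole factor `νmax / h` of the elementwise bounds, squared, on the velocity gradient. -/
lemma exists_boundaryTerm_le (d k : ℕ) (hd : 2 ≤ d) (κ Q : ℝ) (hκ : 0 < κ) (hQ : 0 < Q) :
    ∃ C : ℝ, 0 < C ∧ ∀ (Ω : Set (Euc d)) (K : Geometry.SimplicialComplex ℝ (Euc d)),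
      IsLipschitzDomain Ω → IsTriangulation Ω K → IsShapeRegular K κ → IsQuasiUniform K Q →
      ∀ (ν : Euc d → ℝ) (νmax : ℝ), (∀ x ∈ closure Ω, |ν x| ≤ νmax) → 0 ≤ νmax →
      ∀ (v : Euc d → Euc d) (q : Euc d → ℝ), (∀ i, IsPiecewisePoly K k fun x => v x i) →
        IsPiecewisePoly K k q →
        |boundaryTerm Ω K ν q v| ≤ 1 / 4 * (∫ x in Ω, ‖gradient q x‖ ^ 2)
          + C * νmax ^ 2 / meshSize K ^ 2 * ∫ x in Ω, jacSq v x := by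
  obtain ⟨C, hC, h⟩ := exists_element_boundary_le d k hd κ hκ
  refine ⟨(C * Q) ^ 2, by positivity, ?_⟩
  intro Ω K hΩ hK hS hQu ν νmax hν hνmax v q hv hq
  rw [boundaryTerm, finsum_mem_eq_finite_toFinset_sum _ hK.finite_elements,
    hK.setIntegral_eq_sum hΩ (integrable_gradient_sq hΩ hK hq),
    hK.setIntegral_eq_sum hΩ (integrable_jacSq hΩ hK hv), Finset.mul_sum, Finset.mul_sum,
    ← Finset.sum_add_distrib]
  refine (Finset.abs_sum_le_sum_abs _ _).trans (Finset.sum_le_sum fun t ht => ?_)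
  rw [Set.Finite.mem_toFinset] at ht
  refine (h Ω K hK hS ν νmax hν hνmax v q hv hq t ht).trans ?_
  have hpos := hS.elementSize_pos (by omega) ht
  have hmesh := meshSize_pos (by omega) hK hS ht
  set E := ∫ x in cell t, ‖gradient q x‖ ^ 2
  set D := ∫ x in cell t, jacSq v x
  have hE0 : 0 ≤ E := integral_nonneg fun x => by positivity
  have hD0 : 0 ≤ D := integral_nonneg fun x => jacSq_nonneg v x
  have h1 : (elementSize t)⁻¹ ≤ Q / meshSize K := by
    have := hQu t ht
    rw [div_le_iff₀ hpos] at this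
    rw [inv_eq_one_div, div_le_div_iff₀ hpos hmesh]
    linarith
  have h2 : C * νmax / elementSize t ≤ C * Q * νmax / meshSize K := by
    calc C * νmax / elementSize t = C * νmax * (elementSize t)⁻¹ := by ring
      _ ≤ C * νmax * (Q / meshSize K) := by gcongr
      _ = _ := by ring
  calc _ ≤ C * Q * νmax / meshSize K * (√E * √D) := by gcongr
    _ ≤ 1 / 4 * √E ^ 2 + (C * Q * νmax / meshSize K) ^ 2 * √D ^ 2 := by
        nlinarith [sq_nonneg (1 / 2 * √E - C * Q * νmax / meshSize K * √D)]
    _ = _ := by rw [Real.sq_sqrt hE0, Real.sq_sqrt hD0]; ring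

end Trace

/-! ### Finite-dimensionality of the discrete spaces -/

section FiniteDimensional

variable {d : ℕ} {Ω : Set (Euc d)} {K : Geometry.SimplicialComplex ℝ (Euc d)} {k : ℕ}

/-- A space of tuples of piecewise polynomials of bounded degree embeds into the range of a linear
map on the product, over the elements, of the polynomials of that degree. -/
lemma IsTriangulation.finiteDimensional (hK : IsTriangulation Ω K) {E ι : Type*} [Finite ι]
    [AddCommGroup E] [Module ℝ E] (c : E →ₗ[ℝ] ι → Euc d → ℝ) (hc : Function.Injective c)
    (hP : ∀ x i, IsPiecewisePoly K k (c x i)) (h0 : ∀ x i, ∀ y ∉ closure Ω, c x i y = 0) :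
    FiniteDimensional ℝ E := by
  have := hK.finite_elements.to_subtype
  let V := MvPolynomial.restrictTotalDegree (Fin d) ℝ k
  let Ψ : (elements K → ι → V) →ₗ[ℝ] (elements K → ι → Euc d → ℝ) :=
    { toFun := fun P t i => (cell t.1).indicator (polyEval (P t i).1)
      map_add' := fun P P' => by
        ext t i y
        by_cases hy : y ∈ cell t.1 <;> simp [hy, polyEval]
      map_smul' := fun a P => by
        ext t i y
        by_cases hy : y ∈ cell t.1 <;> simp [hy, polyEval] }
  let Φ : E →ₗ[ℝ] (elements K → ι → Euc d → ℝ) :=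
    { toFun := fun x t i => (cell t.1).indicator (c x i)
      map_add' := fun x x' => by
        ext t i y
        by_cases hy : y ∈ cell t.1 <;> simp [hy]
      map_smul' := fun a x => by
        ext t i y
        by_cases hy : y ∈ cell t.1 <;> simp [hy] }
  have hΦ (x : E) : Φ x ∈ LinearMap.range Ψ := by
    choose P hPk hPe using fun (t : elements K) i => hP x i t.1 t.2
    refine ⟨fun t i => ⟨P t i, (MvPolynomial.mem_restrictTotalDegree _ _ _).2 (hPk t i)⟩, ?_⟩
    ext t i y
    by_cases hy : y ∈ cell t.1
    · simp [Ψ, Φ, hy, hPe t i y hy, polyEval]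
    · simp [Ψ, Φ, hy]
  have hinj : Function.Injective Φ := by
    intro x x' h
    refine hc (funext fun i => funext fun y => ?_)
    by_cases hy : y ∈ closure Ω
    · obtain ⟨t, ht, hyt⟩ := hK.exists_mem_cell hy
      have h1 := congrFun (congrFun (congrFun h ⟨t, ht⟩) i) y
      simpa [Φ, hyt] using h1
    · rw [h0 x i y hy, h0 x' i y hy]
  exact Module.Finite.of_injective (Φ.codRestrict (LinearMap.range Ψ) hΦ)
    ((LinearMap.injective_codRestrict_iff ..).2 hinj)

lemma finiteDimensional_velocity (hK : IsTriangulation Ω K) {X : Submodule ℝ (Euc d → Euc d)}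
    (hX : ∀ v ∈ X, IsDiscreteVelocity Ω K k v) : FiniteDimensional ℝ X :=
  hK.finiteDimensional (E := X) (ι := Fin d) (k := k)
    { toFun := fun v i x => (v : Euc d → Euc d) x i
      map_add' := fun v w => by ext; simp
      map_smul' := fun a v => by ext; simp }
    (fun v w h => by
      ext x i
      exact congrFun (congrFun h i) x)
    (fun v i => (hX v v.2).piecewisePoly i)
    (fun v i y hy => by simp [(hX v v.2).eq_zero_outside y hy])

lemma finiteDimensional_pressure (hK : IsTriangulation Ω K) {Y : Submodule ℝ (Euc d → ℝ)}
    (hY : ∀ q ∈ Y, IsDiscretePressure Ω K k q) : FiniteDimensional ℝ Y :=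
  hK.finiteDimensional (E := Y) (ι := Unit) (k := k)
    { toFun := fun q _ x => (q : Euc d → ℝ) x
      map_add' := fun v w => by ext; simp
      map_smul' := fun a v => by ext; simp }
    (fun v w h => by
      ext x
      exact congrFun (congrFun h ()) x)
    (fun q _ => (hY q q.2).piecewisePoly)
    (fun q _ y hy => (hY q q.2).eq_zero_outside y hy)

end FiniteDimensional

/-! ### Vanishing gradients -/

section Definite

variable {d : ℕ} {Ω : Set (Euc d)} {K : Geometry.SimplicialComplex ℝ (Euc d)} {k : ℕ}

/-- A continuous piecewise polynomial with vanishing gradient takes one value on each element, hence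
finitely many values on the connected closure of the domain, hence one value. -/
lemma IsPiecewisePoly.exists_eq_const (hΩ : IsLipschitzDomain Ω) (hK : IsTriangulation Ω K)
    {q : Euc d → ℝ} (hc : ContinuousOn q (closure Ω)) (hq : IsPiecewisePoly K k q)
    (hgrad : ∀ i, ∀ᵐ x ∂(volume.restrict Ω), gradient q x i = 0) :
    ∃ c, ∀ x ∈ closure Ω, q x = c := by
  have hcell : ∀ t ∈ elements K, ∃ c, ∀ x ∈ cell t, q x = c := fun t ht => by
    obtain ⟨P, -, hP⟩ := hq t ht
    have hconv : Convex ℝ (cell t) := convex_convexHull ℝ _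
    have hint := interior_cell_nonempty ht
    have hzero : ∀ i, ∀ x ∈ interior (cell t), polyEval (MvPolynomial.pderiv i P) x = 0 := by
      intro i
      refine Measure.eqOn_open_of_ae_eq (μ := volume) (g := fun _ => (0 : ℝ)) ?_ isOpen_interior
        (continuous_polyEval _).continuousOn continuousOn_const
      have h1 := ae_restrict_of_ae_restrict_of_subset (hK.interior_cell_subset hΩ ht) (hgrad i)
      filter_upwards [h1, ae_restrict_mem isOpen_interior.measurableSet] with x hx hxt
      rw [← hx, gradient_eq_gradElem q hxt, gradElem_apply_eq ht hP (interior_subset hxt)]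
    have hfderiv : ∀ x ∈ cell t, fderivWithin ℝ (polyEval P) (cell t) x = 0 := by
      intro x hx
      rw [(hasFDerivAt_polyEval P x).hasFDerivWithinAt.fderivWithin (uniqueDiffOn_cell ht x hx)]
      refine Finset.sum_eq_zero fun i _ => ?_
      have hx' : x ∈ closure (interior (cell t)) := by
        rw [hconv.closure_interior_eq_closure_of_nonempty_interior hint]
        exact subset_closure hx
      have h2 : EqOn (polyEval (MvPolynomial.pderiv i P)) (fun _ => (0 : ℝ))
          (closure (interior (cell t))) :=
        (show EqOn _ _ _ from hzero i).closure (continuous_polyEval _) continuous_const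
      rw [h2 hx', zero_smul]
    obtain ⟨y, hy⟩ := hint
    refine ⟨polyEval P y, fun x hx => ?_⟩
    rw [hP x hx]
    exact hconv.is_const_of_fderivWithin_eq_zero (𝕜 := ℝ)
      (fun z _ => (hasFDerivAt_polyEval P z).differentiableAt.differentiableWithinAt)
      hfderiv hx (interior_subset hy)
  choose! c hcc using hcell
  have hmaps : MapsTo q (closure Ω) (c '' elements K) := fun x hx => by
    obtain ⟨t, ht, hxt⟩ := hK.exists_mem_cell hx
    exact ⟨t, ht, (hcc t ht x hxt).symm⟩
  obtain ⟨y, hy⟩ := hΩ.isConnected.nonempty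
  exact ⟨q y, fun x hx => hΩ.isConnected.isPreconnected.closure.constant_of_mapsTo
    (hK.finite_elements.image c).isDiscrete hc hmaps hx (subset_closure hy)⟩

lemma IsLipschitzDomain.volume_real_pos (hΩ : IsLipschitzDomain Ω) :
    0 < (volume : Measure (Euc d)).real Ω :=
  ENNReal.toReal_pos (hΩ.isOpen.measure_pos _ hΩ.isConnected.nonempty).ne'
    hΩ.isBounded.measure_lt_top.ne

lemma IsDiscretePressure.eq_zero (hΩ : IsLipschitzDomain Ω) (hK : IsTriangulation Ω K)
    {q : Euc d → ℝ} (hq : IsDiscretePressure Ω K k q)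
    (hgrad : ∀ᵐ x ∂(volume.restrict Ω), gradient q x = 0) : q = 0 := by
  obtain ⟨c, hc⟩ := hq.piecewisePoly.exists_eq_const hΩ hK hq.continuousOn fun i => by
    filter_upwards [hgrad] with x hx
    simp [hx]
  have h1 := hq.zero_mean
  rw [setIntegral_congr_fun hΩ.isOpen.measurableSet fun x hx => hc x (subset_closure hx),
    setIntegral_const, smul_eq_mul] at h1
  have hc0 : c = 0 := (mul_eq_zero.1 h1).resolve_left hΩ.volume_real_pos.ne'
  funext x
  by_cases hx : x ∈ closure Ω
  · rw [hc x hx, hc0, Pi.zero_apply]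
  · exact hq.eq_zero_outside x hx

lemma IsDiscreteVelocity.eq_zero (hd : 0 < d) (hΩ : IsLipschitzDomain Ω) (hK : IsTriangulation Ω K)
    {v : Euc d → Euc d} (hv : IsDiscreteVelocity Ω K k v)
    (hgrad : ∀ᵐ x ∂(volume.restrict Ω), jacSq v x = 0) : v = 0 := by
  have hfr : (frontier Ω).Nonempty := by
    rw [nonempty_frontier_iff]
    refine ⟨hΩ.isConnected.nonempty, fun h => ?_⟩
    have : Nontrivial (Euc d) :=
      have : Nonempty (Fin d) := ⟨⟨0, hd⟩⟩
      inferInstance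
    exact NormedSpace.unbounded_univ ℝ (Euc d) (h ▸ hΩ.isBounded)
  obtain ⟨y, hy⟩ := hfr
  ext x i
  by_cases hx : x ∈ closure Ω
  · obtain ⟨c, hc⟩ := (hv.piecewisePoly i).exists_eq_const hΩ hK
      ((EuclideanSpace.proj i : Euc d →L[ℝ] ℝ).continuous.comp_continuousOn hv.continuousOn)
      fun j => by
        filter_upwards [hgrad, hK.ae_exists_mem_interior hΩ] with x hx0 ⟨t, ht, hxt⟩
        choose P hP using fun i => hv.piecewisePoly i t ht
        have h1 : jac v x i j = 0 :=
          pow_eq_zero_iff two_ne_zero |>.1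
            (le_antisymm ((sq_jac_le_jacSq v x i j).trans_eq hx0) (sq_nonneg _))
        change gradient (fun x => v x i) x j = 0
        rw [gradient_eq_gradElem _ hxt, gradElem_apply_eq ht (hP i).2 (interior_subset hxt),
          ← h1, jac_eq_jacElem v hxt, jacElem_apply_eq ht (fun i => (hP i).2) (interior_subset hxt)]
    have h3 : v y i = c := hc y (frontier_subset_closure hy)
    rw [hv.eq_zero_boundary y hy] at h3
    exact (hc x hx).trans h3.symm
  · rw [hv.eq_zero_outside x hx]; rfl

end Definite

/-! ### Bilinearity of the stabilised form -/

section Form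

variable {d : ℕ} {Ω : Set (Euc d)} {K : Geometry.SimplicialComplex ℝ (Euc d)} {k : ℕ}
  {X : Submodule ℝ (Euc d → Euc d)} {Y : Submodule ℝ (Euc d → ℝ)}

lemma inner_eq_sum (x y : Euc d) : inner ℝ x y = ∑ i, x i * y i := by
  simp [PiLp.inner_apply, mul_comm]

lemma gradTMul_apply (u g : Euc d → Euc d) (x : Euc d) (i : Fin d) :
    gradTMul u g x i = ∑ j, g x j * jac u x j i := by
  simp [gradTMul, Matrix.mulVec, dotProduct, mul_comm]

lemma memLp_apply {μ : Measure (Euc d)} {p : ENNReal} {g : Euc d → Euc d} (hg : MemLp g p μ)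
    (i : Fin d) : MemLp (fun x => g x i) p μ :=
  (EuclideanSpace.proj i : Euc d →L[ℝ] ℝ).comp_memLp' hg

lemma aeLinear_gradTMul (hΩ : IsLipschitzDomain Ω) (hK : IsTriangulation Ω K)
    (hX : ∀ v ∈ X, IsDiscreteVelocity Ω K k v) {g : Euc d → Euc d}
    (hg : MemLp g ⊤ (volume.restrict Ω)) (i : Fin d) :
    AELinear (volume.restrict Ω) fun (v : X) x => gradTMul (v : Euc d → Euc d) g x i := by
  simp only [gradTMul_apply]
  exact AELinear.sum _ fun j _ => (aeLinear_jac hΩ hK hX j i).mul_left (memLp_apply hg j)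

lemma aeLinear_trace_jac (hΩ : IsLipschitzDomain Ω) (hK : IsTriangulation Ω K)
    (hX : ∀ v ∈ X, IsDiscreteVelocity Ω K k v) :
    AELinear (volume.restrict Ω) fun (v : X) x => (jac (v : Euc d → Euc d) x).trace :=
  AELinear.sum _ fun i _ => aeLinear_jac hΩ hK hX i i

lemma IsBilinear.congr {E E' : Type*} [AddCommGroup E] [Module ℝ E] [AddCommGroup E'] [Module ℝ E']
    {B B' : E → E' → ℝ} (h : IsBilinear B) (e : ∀ x y, B x y = B' x y) : IsBilinear B' := by
  obtain ⟨L, hL⟩ := h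
  exact ⟨L, fun x y => (hL x y).trans (e x y)⟩

/-- The arguments are the pair `z = (u, p)` of trial functions and the pair `w = (v, q)` of test
functions, although the form does not depend on `q`. -/
lemma isBilinear_momentumForm (hΩ : IsLipschitzDomain Ω) (hK : IsTriangulation Ω K)
    (hX : ∀ v ∈ X, IsDiscreteVelocity Ω K k v) (hY : ∀ q ∈ Y, IsDiscretePressure Ω K k q)
    {ν : Euc d → ℝ} {g : Euc d → Euc d} (hν : IsW1Infty Ω ν g) (σ : ℝ) :
    IsBilinear fun z w : X × Y => momentumForm Ω σ ν g z.1 z.2 w.1 := by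
  have := hΩ.isFiniteMeasure
  have hu (i : Fin d) :
      AELinear (volume.restrict Ω) fun (z : X × Y) x => (z.1 : Euc d → Euc d) x i :=
    (aeLinear_velocity hΩ hK hX i).comp_linearMap (LinearMap.fst ℝ X Y)
  have hJ (i j : Fin d) :
      AELinear (volume.restrict Ω) fun (z : X × Y) x => jac (z.1 : Euc d → Euc d) x i j :=
    (aeLinear_jac hΩ hK hX i j).comp_linearMap (LinearMap.fst ℝ X Y)
  have hT (i : Fin d) :
      AELinear (volume.restrict Ω) fun (z : X × Y) x => gradTMul (z.1 : Euc d → Euc d) g x i :=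
    (aeLinear_gradTMul hΩ hK hX hν.memLp_grad i).comp_linearMap (LinearMap.fst ℝ X Y)
  have hdiv :
      AELinear (volume.restrict Ω) fun (z : X × Y) x => (jac (z.1 : Euc d → Euc d) x).trace :=
    (aeLinear_trace_jac hΩ hK hX).comp_linearMap (LinearMap.fst ℝ X Y)
  have hp : AELinear (volume.restrict Ω) fun (z : X × Y) x => (z.2 : Euc d → ℝ) x :=
    (aeLinear_pressure hΩ hK hY).comp_linearMap (LinearMap.snd ℝ X Y)
  refine IsBilinear.sub (.sub (.add (.const_mul ?_ σ) ?_) ?_) ?_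
  · exact (IsBilinear.of_integral_sum Finset.univ (fun i _ => hu i) fun i _ => hu i).congr
      fun z w => by simp only [inner_eq_sum]
  · refine (IsBilinear.of_integral_sum (Finset.univ : Finset (Fin d × Fin d))
      (fun i _ => (hJ i.1 i.2).mul_left hν.memLp) fun i _ => hJ i.1 i.2).congr fun z w => ?_
    refine integral_congr_ae (Filter.Eventually.of_forall fun x => ?_)
    simp only [Fintype.sum_prod_type, Finset.mul_sum, mul_assoc]
  · exact (IsBilinear.of_integral_sum Finset.univ (fun i _ => hT i) fun i _ => hu i).congr
      fun z w => by simp only [inner_eq_sum]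
  · exact IsBilinear.of_integral hp hdiv

lemma isBilinear_boundaryTerm (hd : d = 2 ∨ d = 3) (hK : IsTriangulation Ω K)
    (hX : ∀ v ∈ X, IsDiscreteVelocity Ω K k v) (hY : ∀ q ∈ Y, IsDiscretePressure Ω K k q)
    {ν : Euc d → ℝ} (hν : ContinuousOn ν (closure Ω)) :
    IsBilinear fun z w : X × Y => boundaryTerm Ω K ν w.2 z.1 := by
  classical
  have hd2 : 2 ≤ d := by omega
  simp only [boundaryTerm]
  simp only [finsum_mem_eq_finite_toFinset_sum _ hK.finite_elements]
  refine IsBilinear.sum _ fun t ht => IsBilinear.sum _ fun a ha => ?_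
  rw [Set.Finite.mem_toFinset] at ht
  have ha := (Finset.mem_filter.1 ha).1
  set F := cell (t.erase a) with hF
  set n := (outwardNormal t a).ofLp
  have hFc : IsCompact F := isCompact_cell _
  have hFt : F ⊆ cell t := convexHull_mono (by simp)
  set μ : Measure (Euc d) := (μHE[d - 1] : Measure (Euc d)).restrict F with hμ
  have : IsFiniteMeasure μ := by
    convert! isFiniteMeasure_restrict.2 (measureReal_face_le hd2 ht ha).1.ne
  have hνF : MemLp ν ⊤ μ :=
    memLp_top_restrict_of_continuousOn hFc (hν.mono (hFt.trans (hK.cell_subset ht)))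
  have hq (i : Fin d) : AELinear μ fun (z : X × Y) x => gradElem t (z.2 : Euc d → ℝ) x i :=
    (aeLinear_gradElem ht hFc hFt hY i).comp_linearMap (LinearMap.snd ℝ X Y)
  have hJ (i j : Fin d) : AELinear μ fun (z : X × Y) x => jacElem t (z.1 : Euc d → Euc d) x i j :=
    (aeLinear_jacElem ht hFc hFt hX i j).comp_linearMap (LinearMap.fst ℝ X Y)
  -- The integrand is a sum of products of a component of `ν ∇ × u` and one of `∇q × n`.
  have hcurl (i j i' j' : Fin d) := ((hJ i j).sub (hJ i' j')).mul_left hνF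
  have hcross (i j : Fin d) := ((hq i).const_mul (n j)).sub ((hq j).const_mul (n i))
  rcases hd with rfl | rfl
  · refine (IsBilinear.of_integral (hcurl 1 0 0 1) (hcross 0 1)).congr fun z w => ?_
    refine integral_congr_ae (Filter.Eventually.of_forall fun x => ?_)
    simp only [crossDotCurl]
    ring
  · -- With indices modulo 3, the `i`-th components involve the coordinates `i + 1` and `i + 2`.
    refine (IsBilinear.of_integral_sum (Finset.univ : Finset (Fin 3))
      (fun i _ => hcurl (i + 2) (i + 1) (i + 1) (i + 2))
      (fun i _ => hcross (i + 1) (i + 2))).congr fun z w => ?_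
    refine integral_congr_ae (Filter.Eventually.of_forall fun x => ?_)
    simp only [crossDotCurl, Fin.sum_univ_three, cross_apply, Matrix.vec3_dotProduct,
      Matrix.cons_val_zero, Matrix.cons_val_one, Matrix.cons_val, Fin.isValue, Fin.reduceAdd,
      zero_add]
    ring

lemma isBilinear_continuityForm (hd : d = 2 ∨ d = 3) (hΩ : IsLipschitzDomain Ω)
    (hK : IsTriangulation Ω K)
    (hX : ∀ v ∈ X, IsDiscreteVelocity Ω K k v) (hY : ∀ q ∈ Y, IsDiscretePressure Ω K k q)
    {ν : Euc d → ℝ} {g : Euc d → Euc d} (hν : IsW1Infty Ω ν g) (δ : ℝ) :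
    IsBilinear fun z w : X × Y => continuityForm Ω K δ ν g z.1 z.2 w.2 := by
  have := hΩ.isFiniteMeasure
  have hT (i : Fin d) :
      AELinear (volume.restrict Ω) fun (z : X × Y) x => gradTMul (z.1 : Euc d → Euc d) g x i :=
    (aeLinear_gradTMul hΩ hK hX hν.memLp_grad i).comp_linearMap (LinearMap.fst ℝ X Y)
  have hdiv :
      AELinear (volume.restrict Ω) fun (z : X × Y) x => (jac (z.1 : Euc d → Euc d) x).trace :=
    (aeLinear_trace_jac hΩ hK hX).comp_linearMap (LinearMap.fst ℝ X Y)
  have hp : AELinear (volume.restrict Ω) fun (z : X × Y) x => (z.2 : Euc d → ℝ) x :=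
    (aeLinear_pressure hΩ hK hY).comp_linearMap (LinearMap.snd ℝ X Y)
  have hG (i : Fin d) :
      AELinear (volume.restrict Ω) fun (z : X × Y) x => gradient (z.2 : Euc d → ℝ) x i :=
    (aeLinear_gradient hΩ hK hY i).comp_linearMap (LinearMap.snd ℝ X Y)
  refine IsBilinear.add (.add ?_ (.const_mul ?_ δ))
    (.const_mul (isBilinear_boundaryTerm hd hK hX hY hν.continuousOn) δ)
  · exact (IsBilinear.of_integral hdiv hp).congr fun z w => by simp only [mul_comm]
  · refine (IsBilinear.of_integral_sum Finset.univ (fun i _ => (hG i).sub ((hT i).const_mul 2))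
      fun i _ => hG i).congr fun z w => ?_
    refine integral_congr_ae (Filter.Eventually.of_forall fun x => ?_)
    simp only [inner_eq_sum, PiLp.sub_apply, PiLp.smul_apply, smul_eq_mul, mul_comm]

lemma exists_linearMap_inner_velocity (hΩ : IsLipschitzDomain Ω) (hK : IsTriangulation Ω K)
    (hX : ∀ v ∈ X, IsDiscreteVelocity Ω K k v)
    {f : Euc d → Euc d} (hf : MemLp f 2 (volume.restrict Ω)) :
    ∃ F : X →ₗ[ℝ] ℝ, ∀ v, F v = ∫ x in Ω, (inner ℝ (f x) ((v : Euc d → Euc d) x) : ℝ) := by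
  have := hΩ.isFiniteMeasure
  have hfi (i : Fin d) : Integrable (fun x => f x i) (volume.restrict Ω) :=
    (memLp_apply hf i).integrable one_le_two
  choose L hL using fun i => (aeLinear_velocity hΩ hK hX i).exists_linearMap (hfi i)
  refine ⟨∑ i, L i, fun v => ?_⟩
  simp only [LinearMap.sum_apply, hL, inner_eq_sum]
  rw [integral_finsetSum]
  exact fun i _ => (hfi i).mul_of_top_left ((aeLinear_velocity hΩ hK hX i).memLp v)

lemma exists_linearMap_inner_gradient (hΩ : IsLipschitzDomain Ω) (hK : IsTriangulation Ω K)
    (hY : ∀ q ∈ Y, IsDiscretePressure Ω K k q)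
    {f : Euc d → Euc d} (hf : MemLp f 2 (volume.restrict Ω)) (δ : ℝ) :
    ∃ F : Y →ₗ[ℝ] ℝ, ∀ q,
      F q = ∫ x in Ω, (inner ℝ (f x) (δ • gradient (q : Euc d → ℝ) x) : ℝ) := by
  have := hΩ.isFiniteMeasure
  have hfi (i : Fin d) : Integrable (fun x => f x i) (volume.restrict Ω) :=
    (memLp_apply hf i).integrable one_le_two
  have hq (i : Fin d) := (aeLinear_gradient hΩ hK hY i).const_mul δ
  choose L hL using fun i => (hq i).exists_linearMap (hfi i)
  refine ⟨∑ i, L i, fun q => ?_⟩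
  simp only [LinearMap.sum_apply, hL, inner_eq_sum, PiLp.smul_apply, smul_eq_mul]
  rw [integral_finsetSum]
  exact fun i _ => (hfi i).mul_of_top_left ((hq i).memLp q)

end Form

/-! ### Coercivity -/

section Coercivity

variable {d : ℕ} {Ω : Set (Euc d)} {K : Geometry.SimplicialComplex ℝ (Euc d)} {k : ℕ}

lemma norm_gradTMul_sq_le (v g : Euc d → Euc d) (x : Euc d) :
    ‖gradTMul v g x‖ ^ 2 ≤ jacSq v x * ‖g x‖ ^ 2 := by
  rw [EuclideanSpace.real_norm_sq_eq, EuclideanSpace.real_norm_sq_eq, jacSq, Finset.sum_comm,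
    Finset.sum_mul]
  refine Finset.sum_le_sum fun i _ => ?_
  rw [gradTMul_apply]
  refine (Finset.sum_mul_sq_le_sq_mul_sq _ _ _).trans_eq (mul_comm _ _)

lemma ae_norm_le_supNorm {g : Euc d → Euc d} (hg : MemLp g ⊤ (volume.restrict Ω)) :
    ∀ᵐ x ∂(volume.restrict Ω), ‖g x‖ ≤ supNorm Ω g := by
  filter_upwards [ae_le_eLpNormEssSup (f := g) (μ := volume.restrict Ω)] with x hx
  rw [← eLpNorm_exponent_top] at hx
  exact (ENNReal.toReal_mono hg.2.ne hx).trans' (by simp)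

lemma integrable_inner_of_memLp_top [IsFiniteMeasure (volume.restrict Ω : Measure (Euc d))]
    {u w : Euc d → Euc d}
    (hu : ∀ i, MemLp (fun x => u x i) ⊤ (volume.restrict Ω))
    (hw : ∀ i, MemLp (fun x => w x i) ⊤ (volume.restrict Ω)) :
    Integrable (fun x => (inner ℝ (u x) (w x) : ℝ)) (volume.restrict Ω) := by
  simp only [inner_eq_sum]
  exact integrable_finsetSum _ fun i _ => ((hu i).mul_top (hw i)).integrable le_top

lemma memLp_gradTMul (hΩ : IsLipschitzDomain Ω) (hK : IsTriangulation Ω K)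
    {v : Euc d → Euc d} (hv : ∀ i, IsPiecewisePoly K k fun x => v x i) {g : Euc d → Euc d}
    (hg : MemLp g ⊤ (volume.restrict Ω)) (i : Fin d) :
    MemLp (fun x => gradTMul v g x i) ⊤ (volume.restrict Ω) := by
  simp only [gradTMul_apply]
  exact memLp_finsetSum _ fun j _ => (memLp_apply hg j).mul_top (memLp_jac hΩ hK hv j i)

/-- An almost everywhere bound of the viscosity extends to the boundary, where it is needed for the
boundary term. -/
lemma abs_le_on_closure (hΩ : IsOpen Ω) {ν : Euc d → ℝ} (hc : ContinuousOn ν (closure Ω)) {M : ℝ}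
    (h : ∀ᵐ x ∂(volume.restrict Ω), |ν x| ≤ M) : ∀ x ∈ closure Ω, |ν x| ≤ M := by
  have h1 : EqOn (fun x => max |ν x| M) (fun _ => M) Ω := by
    refine Measure.eqOn_open_of_ae_eq (μ := volume) ?_ hΩ
      ((hc.mono subset_closure).abs.sup continuousOn_const) continuousOn_const
    filter_upwards [h] with x hx
    exact max_eq_right hx
  have h2 : EqOn (fun x => max |ν x| M) (fun _ => M) (closure Ω) :=
    h1.of_subset_closure (hc.abs.sup continuousOn_const) continuousOn_const subset_closure
      Subset.rfl
  exact fun x hx => max_eq_right_iff.1 (h2 hx)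

lemma meshNorm_sq {σ δ νmin : ℝ} (hσ : 0 ≤ σ) (hδ : 0 ≤ δ) (hνmin : 0 ≤ νmin)
    (v : Euc d → Euc d) (q : Euc d → ℝ) :
    meshNorm Ω σ δ νmin (v, q) ^ 2 = σ * (∫ x in Ω, ‖v x‖ ^ 2) + νmin * (∫ x in Ω, jacSq v x)
      + δ * ∫ x in Ω, ‖gradient q x‖ ^ 2 := by
  refine Real.sq_sqrt (add_nonneg (add_nonneg (mul_nonneg hσ ?_) (mul_nonneg hνmin ?_))
    (mul_nonneg hδ ?_))
  · exact integral_nonneg fun x => by positivity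
  · exact integral_nonneg fun x => jacSq_nonneg v x
  · exact integral_nonneg fun x => by positivity

/-- Coercivity, given the bound of the boundary term by interior gradients. The pressure terms
cancel and the three indefinite terms are absorbed by Young's inequality. Of the viscous term, one
sixth is spent on `(∇ᵀv∇ν, v)` and one third on the two indefinite stabilisation terms. -/
lemma coercive_bilinearGL (hΩ : IsLipschitzDomain Ω) (hK : IsTriangulation Ω K)
    {v : Euc d → Euc d} {q : Euc d → ℝ} (hv : IsDiscreteVelocity Ω K k v)
    (hq : IsDiscretePressure Ω K k q) {ν : Euc d → ℝ} {g : Euc d → Euc d} (hν : IsW1Infty Ω ν g)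
    {νmin σ δ β : ℝ} (hνmin : 0 < νmin) (hνle : ∀ᵐ x ∂(volume.restrict Ω), νmin ≤ ν x)
    (hσ : 3 * supNorm Ω g ^ 2 / νmin ≤ σ) (hδ : 0 ≤ δ)
    (hδβ : δ * (4 * supNorm Ω g ^ 2 + β) ≤ νmin / 3)
    (hb : |boundaryTerm Ω K ν q v| ≤ 1 / 4 * (∫ x in Ω, ‖gradient q x‖ ^ 2)
      + β * ∫ x in Ω, jacSq v x) :
    1 / 2 * meshNorm Ω σ δ νmin (v, q) ^ 2 ≤ bilinearGL Ω K σ δ ν g (v, q) (v, q) := by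
  have := hΩ.isFiniteMeasure
  set μ : Measure (Euc d) := volume.restrict Ω with hμ
  set G := supNorm Ω g with hG
  have hσ0 : 0 ≤ σ := le_trans (by positivity) hσ
  have hσG : 3 * G ^ 2 ≤ σ * νmin := (div_le_iff₀ hνmin).1 hσ
  have mv (i : Fin d) : MemLp (fun x => v x i) ⊤ μ := (hv.piecewisePoly i).memLp_top hΩ hK
    ((EuclideanSpace.proj i : Euc d →L[ℝ] ℝ).continuous.comp_continuousOn hv.continuousOn)
  have mT := memLp_gradTMul hΩ hK hv.piecewisePoly hν.memLp_grad
  have mq := hq.piecewisePoly.memLp_gradient hΩ hK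
  have iV : Integrable (fun x => ‖v x‖ ^ 2) μ := by
    simpa only [real_inner_self_eq_norm_sq] using integrable_inner_of_memLp_top mv mv
  have iD : Integrable (jacSq v) μ := integrable_jacSq hΩ hK hv.piecewisePoly
  have iE : Integrable (fun x => ‖gradient q x‖ ^ 2) μ :=
    integrable_gradient_sq hΩ hK hq.piecewisePoly
  set V := ∫ x, ‖v x‖ ^ 2 ∂μ with hV
  set D := ∫ x, jacSq v x ∂μ with hD
  set E := ∫ x, ‖gradient q x‖ ^ 2 ∂μ with hE
  have hD0 : 0 ≤ D := integral_nonneg fun x => jacSq_nonneg v x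
  have hgT : ∀ᵐ x ∂μ, ‖gradTMul v g x‖ ^ 2 ≤ jacSq v x * G ^ 2 := by
    filter_upwards [ae_norm_le_supNorm hν.memLp_grad] with x hx
    have := jacSq_nonneg v x
    exact (norm_gradTMul_sq_le v g x).trans (by gcongr)
  have h1 : ∫ x, (inner ℝ (v x) (v x) : ℝ) ∂μ = V := by simp only [real_inner_self_eq_norm_sq, hV]
  have h2 : νmin * D ≤ ∫ x, ν x * ∑ i, ∑ j, jac v x i j * jac v x i j ∂μ := by
    rw [hD, ← integral_const_mul]
    refine integral_mono_ae (iD.const_mul _) ?_ ?_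
    · simp only [← sq]
      exact iD.mul_of_top_right hν.memLp
    · filter_upwards [hνle] with x hx
      simp only [← sq]
      exact mul_le_mul_of_nonneg_right hx (jacSq_nonneg v x)
  have h3 : ∫ x, (inner ℝ (gradTMul v g x) (v x) : ℝ) ∂μ ≤ νmin / 6 * D + σ / 2 * V := by
    rw [hD, hV, ← integral_const_mul, ← integral_const_mul,
      ← integral_add (iD.const_mul _) (iV.const_mul _)]
    refine integral_mono_ae (integrable_inner_of_memLp_top mT mv)
      ((iD.const_mul _).add (iV.const_mul _)) ?_
    filter_upwards [hgT] with x hx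
    have hj := jacSq_nonneg v x
    refine (real_inner_le_norm _ _).trans (le_of_abs_le (abs_le_of_sq_le_sq ?_ (by positivity)))
    calc (‖gradTMul v g x‖ * ‖v x‖) ^ 2 = ‖gradTMul v g x‖ ^ 2 * ‖v x‖ ^ 2 := by ring
      _ ≤ (jacSq v x * G ^ 2) * ‖v x‖ ^ 2 := by gcongr
      _ ≤ (jacSq v x * (σ * νmin / 3)) * ‖v x‖ ^ 2 := by gcongr; linarith
      _ ≤ (νmin / 6 * jacSq v x + σ / 2 * ‖v x‖ ^ 2) ^ 2 := by
        nlinarith [sq_nonneg (νmin / 6 * jacSq v x - σ / 2 * ‖v x‖ ^ 2)]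
  have h4 : 3 / 4 * E - 4 * G ^ 2 * D ≤
      ∫ x, (inner ℝ (gradient q x) (gradient q x - (2 : ℝ) • gradTMul v g x) : ℝ) ∂μ := by
    rw [hD, hE, ← integral_const_mul, ← integral_const_mul,
      ← integral_sub (iE.const_mul _) (iD.const_mul _)]
    refine integral_mono_ae ((iE.const_mul _).sub (iD.const_mul _))
      (integrable_inner_of_memLp_top mq fun i => (mq i).sub ((mT i).const_mul 2)) ?_
    filter_upwards [hgT] with x hx
    rw [inner_sub_right, inner_smul_right, real_inner_self_eq_norm_sq]
    have h5 := real_inner_le_norm (gradient q x) (gradTMul v g x)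
    nlinarith [sq_nonneg (‖gradient q x‖ / 2 - 2 * ‖gradTMul v g x‖)]
  have h6 := neg_le_of_abs_le hb
  have hform : bilinearGL Ω K σ δ ν g (v, q) (v, q) =
      σ * (∫ x, (inner ℝ (v x) (v x) : ℝ) ∂μ)
      + (∫ x, ν x * ∑ i, ∑ j, jac v x i j * jac v x i j ∂μ)
      - (∫ x, (inner ℝ (gradTMul v g x) (v x) : ℝ) ∂μ)
      + δ * (∫ x, (inner ℝ (gradient q x) (gradient q x - (2 : ℝ) • gradTMul v g x) : ℝ) ∂μ)
      + δ * boundaryTerm Ω K ν q v := by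
    simp only [bilinearGL, momentumForm, continuityForm]
    ring
  have hnorm : meshNorm Ω σ δ νmin (v, q) ^ 2 = σ * V + νmin * D + δ * E :=
    meshNorm_sq hσ0 hδ hνmin.le v q
  rw [hform, hnorm, h1]
  have h7 := mul_le_mul_of_nonneg_left h4 hδ
  have h8 := mul_le_mul_of_nonneg_left h6 hδ
  have h9 := mul_le_mul_of_nonneg_right hδβ hD0
  nlinarith

lemma gradients_eq_zero_of_meshNorm (hΩ : IsLipschitzDomain Ω) (hK : IsTriangulation Ω K)
    {v : Euc d → Euc d} {q : Euc d → ℝ} (hv : IsDiscreteVelocity Ω K k v)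
    (hq : IsDiscretePressure Ω K k q) {νmin σ δ : ℝ} (hσ : 0 ≤ σ) (hνmin : 0 < νmin) (hδ : 0 < δ)
    (h : meshNorm Ω σ δ νmin (v, q) ^ 2 ≤ 0) :
    (∀ᵐ x ∂(volume.restrict Ω), jacSq v x = 0) ∧ ∀ᵐ x ∂(volume.restrict Ω), gradient q x = 0 := by
  have iD := integrable_jacSq hΩ hK hv.piecewisePoly
  have iE := integrable_gradient_sq hΩ hK hq.piecewisePoly
  have hV0 : 0 ≤ σ * ∫ x in Ω, ‖v x‖ ^ 2 := mul_nonneg hσ (integral_nonneg fun x => by positivity)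
  have hD0 : 0 ≤ ∫ x in Ω, jacSq v x := integral_nonneg fun x => jacSq_nonneg v x
  have hE0 : 0 ≤ ∫ x in Ω, ‖gradient q x‖ ^ 2 := integral_nonneg fun x => by positivity
  have hD1 := mul_nonneg hνmin.le hD0
  have hE1 := mul_nonneg hδ.le hE0
  rw [meshNorm_sq hσ hδ.le hνmin.le] at h
  constructor
  · have h1 : ∫ x in Ω, jacSq v x = 0 :=
      (mul_eq_zero.1 (by linarith : νmin * ∫ x in Ω, jacSq v x = 0)).resolve_left hνmin.ne'
    exact (integral_eq_zero_iff_of_nonneg (jacSq_nonneg v) iD).1 h1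
  · have h1 : ∫ x in Ω, ‖gradient q x‖ ^ 2 = 0 :=
      (mul_eq_zero.1 (by linarith : δ * ∫ x in Ω, ‖gradient q x‖ ^ 2 = 0)).resolve_left hδ.ne'
    filter_upwards [(integral_eq_zero_iff_of_nonneg (fun x => by positivity) iE).1 h1] with x hx
    simpa using hx

end Coercivity

/-! ### Unique solvability -/

theorem mainTheorem2 (d : ℕ) (hd : d = 2 ∨ d = 3) (k : ℕ) (κ Q : ℝ) (hκ : 0 < κ) (hQ : 1 ≤ Q) :
    ∃ C : ℝ, 0 < C ∧
      ∀ (Ω : Set (Euc d)) (K : Geometry.SimplicialComplex ℝ (Euc d)),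
        IsLipschitzDomain Ω → IsTriangulation Ω K → IsShapeRegular K κ → IsQuasiUniform K Q →
      ∀ (X : Submodule ℝ (Euc d → Euc d)) (Y : Submodule ℝ (Euc d → ℝ)),
        (∀ v ∈ X, IsDiscreteVelocity Ω K k v) → (∀ q ∈ Y, IsDiscretePressure Ω K k q) →
      ∀ (f : Euc d → Euc d) (ν : Euc d → ℝ) (gradν : Euc d → Euc d) (νmin νmax σ δ : ℝ),
        MemLp f 2 (volume.restrict Ω) → IsW1Infty Ω ν gradν →
        0 < νmin → (∀ᵐ x ∂(volume.restrict Ω), νmin ≤ ν x ∧ ν x ≤ νmax) →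
        3 * supNorm Ω gradν ^ 2 / νmin ≤ σ →
        0 < δ →
        δ ≤ (νmin * meshSize K ^ 2 / 12) /
          (meshSize K ^ 2 * supNorm Ω gradν ^ 2 + C * νmax ^ 2) →
        (∃! up : (Euc d → Euc d) × (Euc d → ℝ), IsBVSSolution Ω K X Y σ δ ν gradν f up) ∧
        (∀ v ∈ X, ∀ q ∈ Y,
          1 / 2 * meshNorm Ω σ δ νmin (v, q) ^ 2 ≤ bilinearGL Ω K σ δ ν gradν (v, q) (v, q)) := by
  have hd2 : 2 ≤ d := by omega
  obtain ⟨C, hC, hbdry⟩ := exists_boundaryTerm_le d k hd2 κ Q hκ (by linarith)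
  refine ⟨C, hC, ?_⟩
  intro Ω K hΩ hK hS hQu X Y hX hY f ν g νmin νmax σ δ hf hν hνmin hνb hσ hδ hδle
  obtain ⟨y, hy⟩ := hΩ.isConnected.nonempty
  obtain ⟨t, ht, -⟩ := hK.exists_mem_cell (subset_closure hy)
  have hmesh := meshSize_pos (by omega) hK hS ht
  have hνabs : ∀ x ∈ closure Ω, |ν x| ≤ νmax := by
    refine abs_le_on_closure hΩ.isOpen hν.continuousOn ?_
    filter_upwards [hνb] with x hx
    rw [abs_of_pos (hνmin.trans_le hx.1)]
    exact hx.2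
  have hνmax : 0 ≤ νmax := (abs_nonneg _).trans (hνabs y (subset_closure hy))
  set h := meshSize K
  set G := supNorm Ω g
  -- A zero denominator would force `δ ≤ 0`, so the bound on `δ` is never a junk value.
  have hδβ : δ * (4 * G ^ 2 + C * νmax ^ 2 / h ^ 2) ≤ νmin / 3 := by
    have hden : 0 < h ^ 2 * G ^ 2 + C * νmax ^ 2 := by
      rcases (by positivity : 0 ≤ h ^ 2 * G ^ 2 + C * νmax ^ 2).eq_or_lt with h0 | h0
      · rw [← h0, div_zero] at hδle
        linarith
      · exact h0
    rw [le_div_iff₀ hden] at hδle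
    have h2 : 0 < h ^ 2 := by positivity
    have h3 : δ * (4 * G ^ 2 + C * νmax ^ 2 / h ^ 2) =
        δ * (4 * (h ^ 2 * G ^ 2) + C * νmax ^ 2) / h ^ 2 := by field_simp
    rw [h3, div_le_iff₀ h2]
    have h4 : 0 ≤ δ * (C * νmax ^ 2) := by positivity
    nlinarith
  have hcoer : ∀ v ∈ X, ∀ q ∈ Y,
      1 / 2 * meshNorm Ω σ δ νmin (v, q) ^ 2 ≤ bilinearGL Ω K σ δ ν g (v, q) (v, q) :=
    fun v hv q hq => coercive_bilinearGL hΩ hK (hX v hv) (hY q hq) hν hνmin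
      (hνb.mono fun x hx => hx.1) hσ hδ.le hδβ
      (hbdry Ω K hΩ hK hS hQu ν νmax hνabs hνmax v q (hX v hv).piecewisePoly
        (hY q hq).piecewisePoly)
  refine ⟨?_, hcoer⟩
  have := finiteDimensional_velocity hK hX
  have := finiteDimensional_pressure hK hY
  obtain ⟨M, hM'⟩ := isBilinear_momentumForm hΩ hK hX hY hν σ
  obtain ⟨N, hN'⟩ := isBilinear_continuityForm hd hΩ hK hX hY hν δ
  obtain ⟨F, hF⟩ := exists_linearMap_inner_velocity hΩ hK hX hf
  obtain ⟨F', hF'⟩ := exists_linearMap_inner_gradient hΩ hK hY hf δ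
  have hM (z w : X × Y) : M z w = momentumForm Ω σ ν g z.1 z.2 w.1 := hM' z w
  have hN (z w : X × Y) : N z w = continuityForm Ω K δ ν g z.1 z.2 w.2 := hN' z w
  have hpos : ∀ z : X × Y, (M + N) z z ≤ 0 → z = 0 := by
    rintro ⟨v, q⟩ hz
    have h1 := hcoer v v.2 q q.2
    have h2 : bilinearGL Ω K σ δ ν g (v, q) (v, q) = (M + N) (v, q) (v, q) := by
      rw [LinearMap.add_apply, LinearMap.add_apply, hM, hN]
      rfl
    obtain ⟨hv0, hq0⟩ := gradients_eq_zero_of_meshNorm hΩ hK (hX v v.2) (hY q q.2)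
      (le_trans (by positivity) hσ) hνmin hδ (by linarith)
    exact Prod.ext (Subtype.ext ((hX v v.2).eq_zero (by omega) hΩ hK hv0))
      (Subtype.ext ((hY q q.2).eq_zero hΩ hK hq0))
  have hiff : ∀ z : X × Y, (∀ w, (M + N) z w = (F.coprod F') w) ↔
      IsBVSSolution Ω K X Y σ δ ν g f ((z.1 : Euc d → Euc d), (z.2 : Euc d → ℝ)) := by
    have hM0 (z : X × Y) (q : Y) : M z (0, q) = 0 := by
      have h1 : M z (0, q) = M z 0 := (hM _ _).trans (hM z 0).symm
      rw [h1, map_zero]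
    have hN0 (z : X × Y) (v : X) : N z (v, 0) = 0 := by
      have h1 : N z (v, 0) = N z 0 := (hN _ _).trans (hN z 0).symm
      rw [h1, map_zero]
    intro z
    simp only [LinearMap.add_apply, LinearMap.coprod_apply]
    constructor
    · intro hz
      refine ⟨z.1.2, z.2.2, fun v hv => ?_, fun q hq => ?_⟩
      · have h1 := hz (⟨v, hv⟩, 0)
        rw [hN0, map_zero, add_zero, add_zero, hM, hF] at h1
        exact h1
      · have h1 := hz (0, ⟨q, hq⟩)
        rw [hM0, map_zero, zero_add, zero_add, hN, hF'] at h1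
        exact h1
    · intro hz w
      have h1 := hz.momentum w.1 w.1.2
      have h2 := hz.continuity w.2 w.2.2
      rw [hM, hN, hF, hF', h1, h2]
  obtain ⟨z, hz, huniq⟩ := existsUnique_of_pos (M + N) hpos (F.coprod F')
  refine ⟨(z.1, z.2), (hiff z).1 hz, ?_⟩
  rintro ⟨u, p⟩ hup
  have h1 := huniq (⟨u, hup.velocity_mem⟩, ⟨p, hup.pressure_mem⟩) ((hiff _).2 hup)
  rw [← h1]
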